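/- Let $K$ be a number field with ring of integers $O_K$ and fix an embedding $\sigma: K\to\mathbb{C}$. A hermitian $O_K$-module is a finitely generated projective $O_K$-module $E$ with a hermitian inner product on $E_\tau=E\otimes_{O_K,\tau}\mathbb{C}$ for every embedding $\tau:K\to\mathbb{C}$, compatible with complex conjugation; write $E_K=E\otimes_{O_K}K$ and $E_{\mathbb{C}}=E_\sigma$. Let $E$ be a hermitian $O_K$-module and let $H$ be a hermitian line bundle over $\mathrm{Spec}(O_K)$ (a hermitian $O_K$-module that is invertible). Let $E_n=\mathrm{Sym}^n(E)$ with the quotient metric of $E^{\otimes n}$, let $m_n$ be its rank, and put $E_n^\vee(x)=E_n^\vee\otimes H^{\otimes x}=\mathrm{Hom}(E_n,H^{\otimes x})$ with its hermitian norms $\|\cdot\|_\tau$. Let $f\in E_{\mathbb{C}}$ with $f\neq 0$, and let $f_n\in (E_n)_{\mathbb{C}}$ be the image of $f^{\otimes n}$. Suppose that there are real constants $c_1,c_2,c_3$ with $c_2>0$, independent of $n$, such that for every sufficiently large $n$ there are real constants $b_1,b_2$ (which may depend on $n$) for which the following holds: for every sufficiently large integer $x$ there are $P_1,\dots,P_{m_n}\in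 E_n^\vee(x)$ such that - $P_1,\dots,P_{m_n}$ are linearly independent; - $\log\|P_i\|_\tau\le c_1x\log x+b_1x$ for all $i$ and all embeddings $\tau:K\to\mathbb{C}$; - $\log\|\langle P_i,f_n\rangle\|_\sigma\le c_1x\log x-c_2m_nx\log x+c_3x\log x+b_2x$ for all $i$ (with $\log 0=-\infty$). Then $f$ is algebraically independent over $K$ in the following sense: for every $n\ge1$, the smallest $K$-subspace $V_n$ of $(E_n)_K$ such that $f_n\in V_n\otimes_{K,\sigma}\mathbb{C}$ is $(E_n)_K$ itself. In terms of coordinates: in any $K$-basis of $E_K$, the coordinates of $f$ satisfy no nontrivial homogeneous polynomial relation with coefficients in $\sigma(K)$. -/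

import Mathlib

open NumberField Module Filter
open scoped TensorProduct ComplexConjugate

namespace Hermitian

section Complexification

variable {K : Type} [Field K] (σ : K →+* ℂ)

/-- The ring homomorphism `𝓞 K → ℂ` given by the complex embedding `σ` of `K`. -/
abbrev emb : 𝓞 K →+* ℂ := σ.comp (algebraMap (𝓞 K) K)

/-- The complex vector space `E_σ = ℂ ⊗ E`, where `ℂ` is an `𝓞 K`-algebra through `σ`. -/
def Cx (E : Type*) [AddCommGroup E] [Module (𝓞 K) E] : Type _ :=
  letI : Algebra (𝓞 K) ℂ := (emb σ).toAlgebra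
  ℂ ⊗[𝓞 K] E

variable {E : Type*} [AddCommGroup E] [Module (𝓞 K) E]
variable {F : Type*} [AddCommGroup F] [Module (𝓞 K) F]

noncomputable instance : AddCommGroup (Cx σ E) :=
  letI : Algebra (𝓞 K) ℂ := (emb σ).toAlgebra
  (inferInstance : AddCommGroup (ℂ ⊗[𝓞 K] E))

noncomputable instance : Module ℂ (Cx σ E) :=
  letI : Algebra (𝓞 K) ℂ := (emb σ).toAlgebra
  (inferInstance : Module ℂ (ℂ ⊗[𝓞 K] E))

instance [Module.Finite (𝓞 K) E] : FiniteDimensional ℂ (Cx σ E) :=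
  letI : Algebra (𝓞 K) ℂ := (emb σ).toAlgebra
  (inferInstance : Module.Finite ℂ (ℂ ⊗[𝓞 K] E))

/-- The canonical map `E → E_σ`, `e ↦ 1 ⊗ e`. -/
noncomputable def toCx : E →ₛₗ[emb σ] Cx σ E :=
  letI : Algebra (𝓞 K) ℂ := (emb σ).toAlgebra
  { toFun := fun e => ((1 : ℂ) ⊗ₜ[𝓞 K] e : ℂ ⊗[𝓞 K] E)
    map_add' := fun a b => TensorProduct.tmul_add _ _ _
    map_smul' := fun r a => by
      change (1 : ℂ) ⊗ₜ[𝓞 K] (r • a) = (emb σ r) • ((1 : ℂ) ⊗ₜ[𝓞 K] a)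
      rw [← TensorProduct.smul_tmul, TensorProduct.smul_tmul', Algebra.smul_def]
      rfl }

/-- The universal property of `E_σ`. -/
noncomputable def liftCx {W : Type*} [AddCommGroup W] [Module ℂ W] (g : E →ₛₗ[emb σ] W) :
    Cx σ E →ₗ[ℂ] W :=
  letI : Algebra (𝓞 K) ℂ := (emb σ).toAlgebra
  letI : Module (𝓞 K) W := Module.compHom W (emb σ)
  haveI : IsScalarTower (𝓞 K) ℂ W := ⟨fun r z w => by
    rw [Algebra.smul_def, mul_smul]; rfl⟩
  LinearMap.liftBaseChange (M := E) ℂ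
    { toFun := g, map_add' := g.map_add, map_smul' := fun r a => g.map_smulₛₗ r a }

theorem liftCx_toCx {W : Type*} [AddCommGroup W] [Module ℂ W] (g : E →ₛₗ[emb σ] W) (e : E) :
    liftCx σ g (toCx σ e) = g e :=
  one_smul ℂ (g e)

theorem Cx.induction {p : Cx σ E → Prop} (h0 : p 0) (hs : ∀ (z : ℂ) (e : E), p (z • toCx σ e))
    (ha : ∀ u v, p u → p v → p (u + v)) (u : Cx σ E) : p u := by
  let : Algebra (𝓞 K) ℂ := (emb σ).toAlgebra
  refine TensorProduct.induction_on (R := 𝓞 K) (M := ℂ) (N := E) (motive := p) u h0 ?_ ha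
  intro z e
  have h := hs z e
  have h2 : z • toCx σ e = (z ⊗ₜ[𝓞 K] e : ℂ ⊗[𝓞 K] E) := by
    change z • ((1 : ℂ) ⊗ₜ[𝓞 K] e : ℂ ⊗[𝓞 K] E) = _
    rw [TensorProduct.smul_tmul']
    simp
  rwa [h2] at h

theorem Cx.ext {W : Type*} [AddCommGroup W] [Module ℂ W] {g h : Cx σ E →ₗ[ℂ] W}
    (H : ∀ e, g (toCx σ e) = h (toCx σ e)) : g = h := by
  ext u
  induction u using Cx.induction with
  | h0 => simp
  | hs z e => simp [H]
  | ha u v hu hv => simp [hu, hv]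

/-- The complexification `φ_σ : E_σ → F_σ` of an `𝓞 K`-linear map `φ`. -/
noncomputable def mapCx (φ : E →ₗ[𝓞 K] F) : Cx σ E →ₗ[ℂ] Cx σ F :=
  liftCx σ ((toCx σ).comp φ)

theorem mapCx_toCx (φ : E →ₗ[𝓞 K] F) (e : E) : mapCx σ φ (toCx σ e) = toCx σ (φ e) :=
  liftCx_toCx σ _ e

variable (E) in
/-- The canonical map `E_K = K ⊗ E → E_σ`, `k ⊗ e ↦ σ k • (1 ⊗ e)`. -/
noncomputable def genericToCx : K ⊗[𝓞 K] E →ₛₗ[σ] Cx σ E :=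
  letI : Algebra (𝓞 K) ℂ := (emb σ).toAlgebra
  let s : K →ₗ[𝓞 K] ℂ :=
    { toFun := σ, map_add' := map_add σ,
      map_smul' := fun r k => by rw [Algebra.smul_def, map_mul, Algebra.smul_def]; rfl }
  { toFun := fun u => (TensorProduct.map s LinearMap.id u : ℂ ⊗[𝓞 K] E)
    map_add' := fun u v => map_add (TensorProduct.map s LinearMap.id) u v
    map_smul' := fun k u => by
      change TensorProduct.map s LinearMap.id (k • u) =
        σ k • TensorProduct.map s (LinearMap.id : E →ₗ[𝓞 K] E) u
      induction u using TensorProduct.induction_on with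
      | zero => simp
      | tmul a e =>
        rw [TensorProduct.smul_tmul', TensorProduct.map_tmul, TensorProduct.map_tmul,
          TensorProduct.smul_tmul']
        congr 1
        exact map_mul σ k a
      | add u v hu hv => rw [smul_add, map_add, map_add, hu, hv, smul_add] }

theorem genericToCx_tmul (k : K) (e : E) :
    genericToCx σ E (k ⊗ₜ[𝓞 K] e) = σ k • toCx σ e := by
  let : Algebra (𝓞 K) ℂ := (emb σ).toAlgebra
  change (σ k ⊗ₜ[𝓞 K] e : ℂ ⊗[𝓞 K] E) = σ k • ((1 : ℂ) ⊗ₜ[𝓞 K] e : ℂ ⊗[𝓞 K] E)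
  rw [TensorProduct.smul_tmul']
  simp

/-- The complexification `(E_σ)ⁿ → F_σ` of an `𝓞 K`-multilinear map `Eⁿ → F`, by recursion on the
number of variables. -/
noncomputable def multiCx : (n : ℕ) → MultilinearMap (𝓞 K) (fun _ : Fin n => E) F →ₛₗ[emb σ]
    MultilinearMap ℂ (fun _ : Fin n => Cx σ E) (Cx σ F)
  | 0 =>
    { toFun := fun g => MultilinearMap.constOfIsEmpty ℂ _ (toCx σ (g 0))
      map_add' := fun g h => by ext; simp
      map_smul' := fun r g => by ext; simp }
  | n + 1 =>
    { toFun := fun g => (liftCx σ ((multiCx n).comp g.curryLeft)).uncurryLeft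
      map_add' := fun g h => by
        have : liftCx σ ((multiCx n).comp (g + h).curryLeft) =
            liftCx σ ((multiCx n).comp g.curryLeft) + liftCx σ ((multiCx n).comp h.curryLeft) := by
          refine Cx.ext σ fun e => ?_
          rw [LinearMap.add_apply, liftCx_toCx, liftCx_toCx, liftCx_toCx]
          exact map_add (multiCx n) (g.curryLeft e) (h.curryLeft e)
        rw [this]; rfl
      map_smul' := fun r g => by
        have : liftCx σ ((multiCx n).comp (r • g).curryLeft) =
            emb σ r • liftCx σ ((multiCx n).comp g.curryLeft) := by
          refine Cx.ext σ fun e => ?_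
          rw [LinearMap.smul_apply, liftCx_toCx, liftCx_toCx]
          exact LinearMap.map_smulₛₗ (multiCx n) r (g.curryLeft e)
        rw [this]; rfl }

theorem multiCx_toCx : ∀ (n : ℕ) (g : MultilinearMap (𝓞 K) (fun _ : Fin n => E) F) (u : Fin n → E),
    multiCx σ n g (fun i => toCx σ (u i)) = toCx σ (g u)
  | 0, g, u => by
    change toCx σ (g 0) = _
    rw [Subsingleton.elim u 0]
  | n + 1, g, u => by
    change liftCx σ ((multiCx σ n).comp g.curryLeft) (toCx σ (u 0))
      (fun i : Fin n => toCx σ (u i.succ)) = _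
    rw [liftCx_toCx]
    change multiCx σ n (g.curryLeft (u 0)) (fun i : Fin n => toCx σ (u i.succ)) = _
    rw [multiCx_toCx n]
    congr 1
    change g (Fin.cons (u 0) (fun i => u i.succ)) = g u
    congr 1
    exact Fin.cons_self_tail u

end Complexification

/-- A hermitian metric on an `𝓞 K`-module `E`: for each embedding `σ : K → ℂ` a hermitian inner
product on `E_σ` (conjugate-linear in the first variable), compatible with complex conjugation. -/
structure Metric (K : Type) [Field K] (E : Type*) [AddCommGroup E]
    [Module (𝓞 K) E] where
  inner : ∀ σ : K →+* ℂ, Cx σ E →ₗ⋆[ℂ] Cx σ E →ₗ[ℂ] ℂ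
  conj_symm : ∀ σ u v, conj (inner σ v u) = inner σ u v
  pos : ∀ σ u, u ≠ 0 → 0 < (inner σ u u).re
  conj_invariant : ∀ σ (u v : E),
    inner (ComplexEmbedding.conjugate σ) (toCx _ u) (toCx _ v) =
      conj (inner σ (toCx σ u) (toCx σ v))

variable {K : Type} [Field K]
variable {E : Type*} [AddCommGroup E] [Module (𝓞 K) E]

namespace Metric

/-- The norm `‖u‖_σ` of `u ∈ E_σ`. -/
noncomputable def norm (h : Metric K E) (σ : K →+* ℂ) (u : Cx σ E) : ℝ :=
  √(h.inner σ u u).re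

/-- The inner product on `E_σ` in Mathlib's packaging. -/
@[reducible] noncomputable def core (h : Metric K E) (σ : K →+* ℂ) : InnerProductSpace.Core ℂ (Cx σ E) where
  inner u v := h.inner σ u v
  conj_inner_symm u v := h.conj_symm σ u v
  re_inner_nonneg u := by
    by_cases hu : u = 0
    · simp [hu]
    · exact (h.pos σ u hu).le
  add_left u v w := by simp
  smul_left u v r := by simp
  definite u hu := by
    by_contra hne
    have := h.pos σ u hne
    rw [hu] at this
    simp at this

theorem exists_orthonormal [Module.Finite (𝓞 K) E] (h : Metric K E) (σ : K →+* ℂ) :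
    ∃ e : Fin (finrank ℂ (Cx σ E)) → Cx σ E,
      (∀ i j, h.inner σ (e i) (e j) = if i = j then 1 else 0) ∧
      (∀ u, u = ∑ i, h.inner σ (e i) u • e i) ∧
      (∀ u v, h.inner σ u v = ∑ i, conj (h.inner σ (e i) u) * h.inner σ (e i) v) := by
  let := h.core σ
  let : NormedAddCommGroup (Cx σ E) := (h.core σ).toNormedAddCommGroup
  let : InnerProductSpace ℂ (Cx σ E) := InnerProductSpace.ofCore (h.core σ).toCore
  let b := stdOrthonormalBasis ℂ (Cx σ E)
  have h2 : ∀ u, u = ∑ i, h.inner σ (b i) u • b i := fun u => (b.sum_repr' u).symm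
  refine ⟨b, fun i j => b.inner_eq_ite i j, h2, fun u v => ?_⟩
  conv_lhs => rw [h2 v]
  simp only [map_sum, map_smul, smul_eq_mul]
  refine Finset.sum_congr rfl fun i _ => ?_
  rw [h.conj_symm, mul_comm]

end Metric

section Forms

variable {V W : Type*} [AddCommGroup V] [Module ℂ V] [AddCommGroup W] [Module ℂ W]

/-- The sesquilinear form `(u, v) ↦ B (s u) (s v)`. -/
noncomputable def pullForm (B : W →ₗ⋆[ℂ] W →ₗ[ℂ] ℂ) (s : V →ₗ[ℂ] W) : V →ₗ⋆[ℂ] V →ₗ[ℂ] ℂ :=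
  LinearMap.mk₂'ₛₗ (starRingEnd ℂ) (RingHom.id ℂ) (fun u v => B (s u) (s v))
    (by simp) (by simp) (by simp) (by simp)

/-- The sesquilinear form `(u, v) ↦ ∑ i, conj (Φ i u) * Φ i v`. -/
noncomputable def coordForm {I : Type*} [Fintype I] (Φ : I → V →ₗ[ℂ] ℂ) :
    V →ₗ⋆[ℂ] V →ₗ[ℂ] ℂ :=
  LinearMap.mk₂'ₛₗ (starRingEnd ℂ) (RingHom.id ℂ) (fun u v => ∑ i, conj (Φ i u) * Φ i v)
    (by intros; simp [add_mul, Finset.sum_add_distrib])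
    (by intros; simp [Finset.mul_sum, mul_assoc])
    (by intros; simp [mul_add, Finset.sum_add_distrib])
    (by intros; simp [Finset.mul_sum, mul_left_comm])

theorem conj_invariant_of_span {σ : K →+* ℂ} (S : Set E) (hS : Submodule.span (𝓞 K) S = ⊤)
    (B : Cx σ E →ₗ⋆[ℂ] Cx σ E →ₗ[ℂ] ℂ)
    (B' : Cx (ComplexEmbedding.conjugate σ) E →ₗ⋆[ℂ]
      Cx (ComplexEmbedding.conjugate σ) E →ₗ[ℂ] ℂ)
    (h : ∀ u ∈ S, ∀ v ∈ S, B' (toCx _ u) (toCx _ v) = conj (B (toCx σ u) (toCx σ v))) (u v : E) :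
    B' (toCx _ u) (toCx _ v) = conj (B (toCx σ u) (toCx σ v)) := by
  have hu : u ∈ Submodule.span (𝓞 K) S := by simp [hS]
  have hv : v ∈ Submodule.span (𝓞 K) S := by simp [hS]
  induction hu using Submodule.span_induction with
  | mem u hu =>
    induction hv using Submodule.span_induction with
    | mem v hv => exact h u hu v hv
    | zero => simp
    | add a b _ _ ha hb => simp [ha, hb]
    | smul r a _ ha => simp [ha]
  | zero => simp
  | add a b _ _ ha hb => simp [ha, hb]
  | smul r a _ ha => simp [ha]

end Forms

section TensorPower

/-- The linear form on `(E^{⊗ n})_σ` that sends `u₁ ⊗ ⋯ ⊗ uₙ` to `∏ φᵢ uᵢ`. -/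
noncomputable def tensorForm (σ : K →+* ℂ) {n : ℕ} (φ : Fin n → (Cx σ E →ₗ[ℂ] ℂ)) :
    Cx σ (⨂[𝓞 K]^n E) →ₗ[ℂ] ℂ :=
  letI : Algebra (𝓞 K) ℂ := (emb σ).toAlgebra
  let l : MultilinearMap (𝓞 K) (fun _ : Fin n => E) ℂ :=
    (MultilinearMap.mkPiAlgebra (𝓞 K) (Fin n) ℂ).compLinearMap fun i =>
      { toFun := fun u => φ i (toCx σ u)
        map_add' := fun u v => by simp
        map_smul' := fun r u => by simp [Algebra.smul_def]; left; rfl }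
  liftCx σ
    { toFun := PiTensorProduct.lift l
      map_add' := map_add _
      map_smul' := fun r u => by rw [map_smul, Algebra.smul_def]; rfl }

theorem tensorForm_tprod (σ : K →+* ℂ) {n : ℕ} (φ : Fin n → (Cx σ E →ₗ[ℂ] ℂ)) (u : Fin n → E) :
    tensorForm σ φ (toCx σ (PiTensorProduct.tprod (𝓞 K) u)) = ∏ i, φ i (toCx σ (u i)) := by
  unfold tensorForm
  rw [liftCx_toCx]
  let : Algebra (𝓞 K) ℂ := (emb σ).toAlgebra
  exact PiTensorProduct.lift.tprod _

variable [Module.Finite (𝓞 K) E]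

/-- The coordinates of a tensor in the basis of `(E^{⊗ n})_σ` given by the tensor products of the
members of an orthonormal basis of `E_σ`. -/
noncomputable def Metric.tensorCoord (h : Metric K E) (σ : K →+* ℂ) (n : ℕ)
    (I : Fin n → Fin (finrank ℂ (Cx σ E))) : Cx σ (⨂[𝓞 K]^n E) →ₗ[ℂ] ℂ :=
  tensorForm σ fun j => h.inner σ ((h.exists_orthonormal σ).choose (I j))

theorem Metric.tensorCoord_expand (h : Metric K E) (σ : K →+* ℂ) (n : ℕ)
    (t : Cx σ (⨂[𝓞 K]^n E)) :
    t = ∑ I, h.tensorCoord σ n I t • multiCx σ n (PiTensorProduct.tprod (𝓞 K))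
      (fun j => (h.exists_orthonormal σ).choose (I j)) := by
  set e := (h.exists_orthonormal σ).choose with he
  have hexp := (h.exists_orthonormal σ).choose_spec.2.1
  rw [← he] at hexp
  induction t using Cx.induction with
  | h0 => simp
  | ha u v hu hv =>
    conv_lhs => rw [hu, hv]
    simp [add_smul, Finset.sum_add_distrib]
  | hs z t =>
    have key : toCx σ t = ∑ I, h.tensorCoord σ n I (toCx σ t) •
        multiCx σ n (PiTensorProduct.tprod (𝓞 K)) (fun j => e (I j)) := by
      induction t using PiTensorProduct.induction_on with
      | smul_tprod r u =>
        have h1 : toCx σ (PiTensorProduct.tprod (𝓞 K) u) =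
            ∑ I, h.tensorCoord σ n I (toCx σ (PiTensorProduct.tprod (𝓞 K) u)) •
              multiCx σ n (PiTensorProduct.tprod (𝓞 K)) (fun j => e (I j)) := by
          conv_lhs => rw [← multiCx_toCx σ n (PiTensorProduct.tprod (𝓞 K)) u]
          have h2 : (fun i => toCx σ (u i)) =
              fun i => ∑ k, h.inner σ (e k) (toCx σ (u i)) • e k := by
            funext i
            exact hexp _
          rw [h2, MultilinearMap.map_sum]
          refine Finset.sum_congr rfl fun I _ => ?_
          rw [MultilinearMap.map_smul_univ]
          congr 1
          exact (tensorForm_tprod σ _ u).symm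
        rw [LinearMap.map_smulₛₗ]
        conv_lhs => rw [h1]
        simp [Finset.smul_sum, mul_smul]
      | add a b ha hb =>
        rw [map_add]
        conv_lhs => rw [ha, hb]
        simp [add_smul, Finset.sum_add_distrib]
    conv_lhs => rw [key]
    simp [Finset.smul_sum, mul_smul]

theorem Metric.coordForm_tprod (h : Metric K E) (σ : K →+* ℂ) (n : ℕ) (u v : Fin n → E) :
    coordForm (h.tensorCoord σ n) (toCx σ (PiTensorProduct.tprod (𝓞 K) u))
      (toCx σ (PiTensorProduct.tprod (𝓞 K) v)) =
      ∏ i, h.inner σ (toCx σ (u i)) (toCx σ (v i)) := by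
  have hin := (h.exists_orthonormal σ).choose_spec.2.2
  simp_rw [fun i => hin (toCx σ (u i)) (toCx σ (v i))]
  rw [Finset.prod_univ_sum, Fintype.piFinset_univ]
  refine Finset.sum_congr rfl fun I _ => ?_
  unfold Metric.tensorCoord
  rw [tensorForm_tprod, tensorForm_tprod, map_prod, Finset.prod_mul_distrib]

/-- The metric on the tensor power `E^{⊗ n}`; see `Metric.tensorPower_tprod`. -/
noncomputable def Metric.tensorPower (h : Metric K E) (n : ℕ) : Metric K (⨂[𝓞 K]^n E) where
  inner σ := coordForm (h.tensorCoord σ n)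
  conj_symm σ u v := by simp [coordForm, mul_comm]
  pos σ u hu := by
    have h1 : (coordForm (h.tensorCoord σ n) u u).re =
        ∑ I, ‖h.tensorCoord σ n I u‖ ^ 2 := by
      simp only [coordForm, LinearMap.mk₂'ₛₗ_apply, Complex.re_sum]
      refine Finset.sum_congr rfl fun I _ => ?_
      rw [← Complex.normSq_eq_conj_mul_self, Complex.ofReal_re, Complex.normSq_eq_norm_sq]
    rw [h1]
    refine lt_of_le_of_ne (Finset.sum_nonneg fun I _ => sq_nonneg _) fun h0 => hu ?_
    rw [eq_comm, Finset.sum_eq_zero_iff_of_nonneg fun I _ => sq_nonneg _] at h0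
    rw [h.tensorCoord_expand σ n u]
    refine Finset.sum_eq_zero fun I hI => ?_
    have := h0 I hI
    rw [sq_eq_zero_iff, norm_eq_zero] at this
    rw [this, zero_smul]
  conj_invariant σ := conj_invariant_of_span _ (PiTensorProduct.span_tprod_eq_top) _ _ (by
    rintro _ ⟨u, rfl⟩ _ ⟨v, rfl⟩
    rw [h.coordForm_tprod, h.coordForm_tprod, map_prod]
    exact Finset.prod_congr rfl fun i _ => h.conj_invariant σ _ _)

/-- `⟪u₁ ⊗ ⋯ ⊗ uₙ, v₁ ⊗ ⋯ ⊗ vₙ⟫ = ∏ ⟪uᵢ, vᵢ⟫`. -/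
theorem Metric.tensorPower_tprod (h : Metric K E) (σ : K →+* ℂ) (n : ℕ) (u v : Fin n → E) :
    (h.tensorPower n).inner σ (toCx σ (PiTensorProduct.tprod (𝓞 K) u))
      (toCx σ (PiTensorProduct.tprod (𝓞 K) v)) =
      ∏ i, h.inner σ (toCx σ (u i)) (toCx σ (v i)) :=
  h.coordForm_tprod σ n u v

end TensorPower

section SymmetricPower

open Equiv

variable (K E) in
/-- The map `Symⁿ E → E^{⊗ n}`, `u₁ ⋯ uₙ ↦ ∑ π, u_{π 1} ⊗ ⋯ ⊗ u_{π n}`. -/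
noncomputable def symmetrize (n : ℕ) : Sym[𝓞 K]^n E →ₗ[𝓞 K] ⨂[𝓞 K]^n E :=
  let g : ⨂[𝓞 K]^n E →ₗ[𝓞 K] ⨂[𝓞 K]^n E :=
    ∑ π : Perm (Fin n), (PiTensorProduct.reindex (𝓞 K) (fun _ => E) π).toLinearMap
  let g' : Sym[𝓞 K]^n E →+ ⨂[𝓞 K]^n E :=
    AddCon.lift _ g.toAddMonoidHom (AddCon.addConGen_le.mpr (by
      rintro _ _ ⟨e, u⟩
      change g _ = g _
      simp only [g, LinearMap.sum_apply, LinearEquiv.coe_coe, PiTensorProduct.reindex_tprod]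
      refine Fintype.sum_equiv (Equiv.mulRight e) _ _ fun π => ?_
      congr 1
      funext i
      simp [Perm.mul_def]))
  { g' with
    map_smul' := fun r s => by
      induction s using AddCon.induction_on with
      | _ t => exact map_smul g r t }

theorem symmetrize_tprod (n : ℕ) (u : Fin n → E) :
    symmetrize K E n (SymmetricPower.tprod (𝓞 K) u) =
      ∑ π : Perm (Fin n), PiTensorProduct.tprod (𝓞 K) (fun i => u (π i)) := by
  change (∑ π : Perm (Fin n), (PiTensorProduct.reindex (𝓞 K) (fun _ => E) π).toLinearMap)
    (PiTensorProduct.tprod (𝓞 K) u) = _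
  simp only [LinearMap.sum_apply, LinearEquiv.coe_coe, PiTensorProduct.reindex_tprod]
  exact Fintype.sum_equiv (Equiv.inv (Perm (Fin n))) _ _ fun π => rfl

theorem mk_symmetrize (n : ℕ) (s : Sym[𝓞 K]^n E) :
    SymmetricPower.mk (𝓞 K) (Fin n) E (symmetrize K E n s) = (n.factorial : 𝓞 K) • s := by
  have hs : s ∈ Submodule.span (𝓞 K)
      (Set.range (SymmetricPower.tprod (𝓞 K) (ι := Fin n) (M := E))) := by
    simp [SymmetricPower.span_tprod_eq_top]
  induction hs using Submodule.span_induction with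
  | mem s hs =>
    obtain ⟨u, rfl⟩ := hs
    rw [symmetrize_tprod, map_sum]
    have : ∀ π : Perm (Fin n), SymmetricPower.mk (𝓞 K) (Fin n) E
        (PiTensorProduct.tprod (𝓞 K) fun i => u (π i)) = SymmetricPower.tprod (𝓞 K) u :=
      fun π => SymmetricPower.tprod_equiv π u
    simp_rw [this]
    rw [Finset.sum_const, Finset.card_univ, Fintype.card_perm, Fintype.card_fin, Nat.cast_smul_eq_nsmul]
  | zero => simp
  | add a b _ _ ha hb => rw [map_add, map_add, ha, hb, smul_add]
  | smul r a _ ha => rw [map_smul, map_smul, ha, smul_comm]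

/-- The section `u₁ ⋯ uₙ ↦ (1 / n!) ∑ π, u_{π 1} ⊗ ⋯ ⊗ u_{π n}` of the quotient map
`(E^{⊗ n})_σ → (Symⁿ E)_σ`; its values are the lifts orthogonal to the kernel. -/
noncomputable def symmetrizeCx (σ : K →+* ℂ) (n : ℕ) :
    Cx σ (Sym[𝓞 K]^n E) →ₗ[ℂ] Cx σ (⨂[𝓞 K]^n E) :=
  (n.factorial : ℂ)⁻¹ • mapCx σ (symmetrize K E n)

theorem mapCx_mk_symmetrizeCx (σ : K →+* ℂ) (n : ℕ) (s : Cx σ (Sym[𝓞 K]^n E)) :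
    mapCx σ (SymmetricPower.mk (𝓞 K) (Fin n) E) (symmetrizeCx σ n s) = s := by
  have : (mapCx σ (SymmetricPower.mk (𝓞 K) (Fin n) E)) ∘ₗ (symmetrizeCx σ n) =
      (LinearMap.id : Cx σ (Sym[𝓞 K]^n E) →ₗ[ℂ] _) := by
    refine Cx.ext σ fun s => ?_
    simp only [symmetrizeCx, LinearMap.comp_apply, LinearMap.smul_apply, map_smul, mapCx_toCx,
      LinearMap.id_apply]
    rw [mk_symmetrize, LinearMap.map_smulₛₗ, map_natCast, smul_smul, inv_mul_cancel₀, one_smul]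
    exact_mod_cast n.factorial_ne_zero
  exact LinearMap.congr_fun this s

theorem symmetrizeCx_tprod (σ : K →+* ℂ) (n : ℕ) (u : Fin n → E) :
    symmetrizeCx σ n (toCx σ (SymmetricPower.tprod (𝓞 K) u)) = (n.factorial : ℂ)⁻¹ •
      ∑ π : Perm (Fin n), toCx σ (PiTensorProduct.tprod (𝓞 K) (fun i => u (π i))) := by
  rw [symmetrizeCx, LinearMap.smul_apply, mapCx_toCx, symmetrize_tprod, map_sum]

variable [Module.Finite (𝓞 K) E]

/-- The quotient metric on `Symⁿ E`, as a quotient of `E^{⊗ n}`: the metric that makes the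
orthogonal lift `(Symⁿ E)_σ → (E^{⊗ n})_σ` isometric. -/
noncomputable def Metric.symPower (h : Metric K E) (n : ℕ) : Metric K (Sym[𝓞 K]^n E) where
  inner σ := pullForm ((h.tensorPower n).inner σ) (symmetrizeCx σ n)
  conj_symm σ u v := (h.tensorPower n).conj_symm σ _ _
  pos σ u hu := (h.tensorPower n).pos σ _ fun h0 => hu (by
    rw [← mapCx_mk_symmetrizeCx σ n u, h0, map_zero])
  conj_invariant σ := conj_invariant_of_span _ (SymmetricPower.span_tprod_eq_top (𝓞 K) (Fin n) E)
    _ _ (by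
    rintro _ ⟨u, rfl⟩ _ ⟨v, rfl⟩
    simp only [pullForm, LinearMap.mk₂'ₛₗ_apply, symmetrizeCx_tprod]
    simp [(h.tensorPower n).conj_invariant σ])

/-- `⟪u₁ ⋯ uₙ, v₁ ⋯ vₙ⟫ = (1 / n!) ∑ π, ∏ i, ⟪u_{π i}, vᵢ⟫`. -/
theorem Metric.symPower_tprod (h : Metric K E) (σ : K →+* ℂ) (n : ℕ) (u v : Fin n → E) :
    (h.symPower n).inner σ (toCx σ (SymmetricPower.tprod (𝓞 K) u))
      (toCx σ (SymmetricPower.tprod (𝓞 K) v)) =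
      (n.factorial : ℂ)⁻¹ *
        ∑ π : Perm (Fin n), ∏ i, h.inner σ (toCx σ (u (π i))) (toCx σ (v i)) := by
  change pullForm _ _ _ _ = _
  simp only [pullForm, LinearMap.mk₂'ₛₗ_apply, symmetrizeCx_tprod, map_sum, map_smul,
    LinearMap.map_smulₛₗ, LinearMap.smul_apply, LinearMap.sum_apply, h.tensorPower_tprod,
    smul_eq_mul]
  have key : ∀ ρ : Perm (Fin n), ∑ π : Perm (Fin n),
      ∏ i, h.inner σ (toCx σ (u (π i))) (toCx σ (v (ρ i))) =
      ∑ π : Perm (Fin n), ∏ i, h.inner σ (toCx σ (u (π i))) (toCx σ (v i)) := fun ρ =>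
    Fintype.sum_equiv (Equiv.mulRight ρ⁻¹) _ _ fun π =>
      Fintype.prod_equiv ρ _ _ fun i => by simp
  have hn : (n.factorial : ℂ) ≠ 0 := by exact_mod_cast n.factorial_ne_zero
  simp only [key, Finset.sum_const, Finset.card_univ, Fintype.card_perm, Fintype.card_fin,
    nsmul_eq_mul, map_inv₀, map_natCast]
  rw [inv_mul_cancel_left₀ hn]

end SymmetricPower

section Criterion

variable {F : Type*} [AddCommGroup F] [Module (𝓞 K) F]

/-- The norm `‖φ‖_σ` of `φ ∈ Hom(E, F)`: the operator norm of `φ_σ : E_σ → F_σ`. When `F` has rank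
one, `Hom(E, F) = E^∨ ⊗ F` and this is the norm of its hermitian metric. -/
noncomputable def homNorm (hE : Metric K E) (hF : Metric K F) (σ : K →+* ℂ) (φ : E →ₗ[𝓞 K] F) : ℝ :=
  sInf {c : ℝ | 0 ≤ c ∧ ∀ u : Cx σ E, hF.norm σ (mapCx σ φ u) ≤ c * hE.norm σ u}

/-- The image of `f^{⊗ n}` in `(Symⁿ E)_σ`. -/
noncomputable def symPow (σ : K →+* ℂ) (n : ℕ) (f : Cx σ E) : Cx σ (Sym[𝓞 K]^n E) :=
  multiCx σ n (SymmetricPower.tprod (𝓞 K)) fun _ => f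

/-- The complex subspace `W ⊗_K ℂ` of `E_σ`, for a `K`-subspace `W` of `E_K`. -/
noncomputable def subspaceCx (σ : K →+* ℂ) (W : Submodule K (K ⊗[𝓞 K] E)) :
    Submodule ℂ (Cx σ E) :=
  Submodule.span ℂ (genericToCx σ E '' W)

/-- The smallest `K`-subspace `V` of `E_K` such that `f ∈ V ⊗_K ℂ`. -/
noncomputable def minSubspace (σ : K →+* ℂ) (f : Cx σ E) : Submodule K (K ⊗[𝓞 K] E) :=
  sInf {W | f ∈ subspaceCx σ W}

/-- `f ∈ E_σ` is algebraically independent over `K`: for every `n ≥ 1` the smallest `K`-subspace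
of `(Symⁿ E)_K` containing the image of `f^{⊗ n}` is `(Symⁿ E)_K` itself. -/
def AlgIndependent (σ : K →+* ℂ) (f : Cx σ E) : Prop :=
  ∀ n : ℕ, 0 < n → minSubspace σ (symPow σ n f) = ⊤

/-- The hypotheses of the linear independence criterion for `f ∈ E_σ` with constants
`c₁, c₂, c₃, b₁, b₂`. Here `m` is the rank of `E` and `E^∨(x) = Hom(E, H^{⊗ x})`; the
inequalities between logarithms of norms are written after exponentiation, so that a vanishing
norm satisfies them. -/
def SmallForms {H : Type*} [AddCommGroup H] [Module (𝓞 K) H] [Module.Finite (𝓞 K) H]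
    (hE : Metric K E) (hH : Metric K H) (σ : K →+* ℂ) (f : Cx σ E) (c₁ c₂ c₃ b₁ b₂ : ℝ) : Prop :=
  let m := finrank (𝓞 K) E
  ∀ᶠ x : ℕ in atTop, ∃ P : Fin m → (E →ₗ[𝓞 K] ⨂[𝓞 K]^x H),
    LinearIndependent (𝓞 K) P ∧
    (∀ i, ∀ τ : K →+* ℂ, homNorm hE (hH.tensorPower x) τ (P i) ≤
      Real.exp (c₁ * x * Real.log x + b₁ * x)) ∧
    (∀ i, (hH.tensorPower x).norm σ (mapCx σ (P i) f) ≤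
      Real.exp (c₁ * x * Real.log x - c₂ * m * x * Real.log x + c₃ * x * Real.log x + b₂ * x))

end Criterion
end Hermitian

/-!
A homogeneous relation `G` of degree `k` on the coordinates of `f` has many multiples: for `n ≥ k`
the products of `G` with the forms of degree `n - k` give `m_{n-k}` independent integral forms on
`Symⁿ E` vanishing at `f_n`. Complete them by `m_n - m_{n-k}` of the small forms `P_i`, made
integer-valued by pairing with powers of a fixed nonzero form on `H`, to a nonsingular matrix over
`𝓞 K`. The absolute values of the conjugates of its determinant have product at least `1`. By
Cramer's rule, the conjugate at `σ` times a coordinate of `f_n` is the determinant of the matrix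
with one column replaced by the values of the forms at `f_n`; these vanish on the multiples of `G`
and are small on the `P_i`. Comparing coefficients of `x log x` yields
`c₂ m_n ≤ [K : ℚ] (m_n - m_{n-k}) c₁ + c₃` for infinitely many `n`. Since `m_{n-k} / m_n → 1` and
`m_n → ∞`, dividing by `m_n` contradicts `c₂ > 0`.
-/

namespace Hermitian

section FractionField

variable {R : Type*} [CommRing R] (K : Type*) [Field K] [Algebra R K]
variable (M : Type*) [AddCommGroup M] [Module R M]

theorem span_range_one_tmul :
    Submodule.span K (Set.range fun u : M => (1 : K) ⊗ₜ[R] u) = ⊤ := by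
  rw [← Submodule.baseChange_top, Submodule.baseChange_eq_span, Submodule.map_top]
  rfl

instance finiteDimensional_linearMap [Module.Finite R M] : FiniteDimensional K (M →ₗ[R] K) :=
  Module.Finite.equiv (LinearMap.liftBaseChangeEquiv (R := R) (M := M) (N := K) K).symm

variable {M} in
/-- The `K`-valued linear form given by an integral one. -/
def genericForm (Q : Dual R M) : M →ₗ[R] K := Algebra.linearMap R K ∘ₗ Q

variable {K M} in
theorem genericForm_apply (Q : Dual R M) (u : M) : genericForm K Q u = algebraMap R K (Q u) := rfl

variable [IsFractionRing R K]

theorem finrank_baseChange_fractionRing : finrank K (K ⊗[R] M) = finrank R M :=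
  (TensorProduct.isBaseChange R M K).finrank_eq

theorem finrank_linearMap_fractionRing : finrank K (M →ₗ[R] K) = finrank R M := by
  rw [(LinearMap.liftBaseChangeEquiv (R := R) (M := M) (N := K) K).finrank_eq,
    ← finrank_baseChange_fractionRing K M]
  exact Subspace.dual_finrank_eq

theorem exists_basis_eq_one_tmul [Module.Finite R M] :
    ∃ (b : Basis (Fin (finrank R M)) K (K ⊗[R] M)) (e : Fin (finrank R M) → M),
      ∀ j, b j = 1 ⊗ₜ[R] e j := by
  let b₀ := Basis.ofSpan (span_range_one_tmul (R := R) K M).ge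
  have := Module.Finite.finite_basis b₀
  let b := b₀.reindex (Finite.equivFinOfCardEq
    ((finrank_eq_nat_card_basis b₀).symm.trans (finrank_baseChange_fractionRing K M)))
  have hb : ∀ j, b j ∈ Set.range fun u : M => (1 : K) ⊗ₜ[R] u := fun j => by
    rw [Basis.reindex_apply]
    exact Basis.ofSpan_subset _ ⟨_, rfl⟩
  choose e he using hb
  exact ⟨b, e, fun j => (he j).symm⟩

end FractionField

section IntegralForms

variable {R K M : Type*} [CommRing R] [IsDomain R] [Field K] [Algebra R K] [IsFractionRing R K]
variable [AddCommGroup M] [Module R M]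

theorem exists_smul_basis_eq_one_tmul {ι : Type*} [Finite ι] (b : Basis ι K (K ⊗[R] M)) :
    ∃ (a : R) (b' : Basis ι K (K ⊗[R] M)) (e : ι → M), a ≠ 0 ∧
      (∀ j, b' j = algebraMap R K a • b j) ∧ ∀ j, b' j = 1 ⊗ₜ[R] e j := by
  obtain ⟨⟨a, ha⟩, hint⟩ := IsLocalizedModule.exist_integer_multiples_of_finite
    (nonZeroDivisors R) (TensorProduct.mk R K M 1) b
  choose e he using hint
  have ha0 : a ≠ 0 := nonZeroDivisors.ne_zero ha
  have ha' : algebraMap R K a ≠ 0 := IsFractionRing.to_map_ne_zero_of_mem_nonZeroDivisors ha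
  refine ⟨a, b.unitsSMul fun _ => Units.mk0 _ ha', e, ha0, fun j => b.unitsSMul_apply j,
    fun j => ?_⟩
  rw [b.unitsSMul_apply, Units.smul_mk0, algebraMap_smul]
  exact (he j).symm

theorem exists_genericForm_eq_smul [Module.Finite R M] {ι : Type*} [Finite ι] (L : ι → M →ₗ[R] K) :
    ∃ (a : R) (Q : ι → Dual R M), a ≠ 0 ∧ ∀ i, genericForm K (Q i) = algebraMap R K a • L i := by
  obtain ⟨s, hs⟩ := Module.Finite.fg_top (R := R) (M := M)
  obtain ⟨⟨a, ha⟩, hint⟩ := IsLocalization.exist_integer_multiples_of_finite (nonZeroDivisors R)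
    fun p : ι × s => L p.1 p.2
  have hmem : ∀ i u, a • L i u ∈ LinearMap.range (Algebra.linearMap R K) := fun i u => by
    have hu : u ∈ Submodule.span R (s : Set M) := hs ▸ Submodule.mem_top
    induction hu using Submodule.span_induction with
    | mem u hu => exact hint (i, ⟨u, hu⟩)
    | zero => simp
    | add u v _ _ hu hv => rw [map_add, smul_add]; exact add_mem hu hv
    | smul r u _ hu => rw [map_smul, smul_comm]; exact Submodule.smul_mem _ r hu
  let ρ := LinearEquiv.ofInjective (Algebra.linearMap R K) (IsFractionRing.injective R K)
  refine ⟨a, fun i => ρ.symm ∘ₗ (a • L i).codRestrict _ (hmem i), nonZeroDivisors.ne_zero ha,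
    fun i => LinearMap.ext fun u => ?_⟩
  rw [LinearMap.smul_apply, algebraMap_smul]
  exact congrArg Subtype.val (ρ.apply_symm_apply ⟨a • L i u, hmem i u⟩)

theorem det_ne_zero_of_linearIndependent_forms {J : Type*} [Fintype J] [DecidableEq J]
    (b : Basis J K (K ⊗[R] M)) {e : J → M} (hb : ∀ j, b j = 1 ⊗ₜ[R] e j) {Q : J → Dual R M}
    (hQ : LinearIndependent K fun i => genericForm K (Q i)) :
    (Matrix.of fun i j => Q i (e j)).det ≠ 0 := by
  intro h0
  obtain ⟨v, hv, hv0⟩ := Matrix.exists_vecMul_eq_zero_iff.mpr h0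
  have hsum : ∑ i, algebraMap R K (v i) • genericForm K (Q i) = 0 := by
    refine (LinearMap.liftBaseChangeEquiv K).injective (b.ext fun j => ?_)
    have := congrArg (algebraMap R K) (congrFun hv0 j)
    simpa [hb, Matrix.vecMul, dotProduct, genericForm_apply, Algebra.smul_def] using this
  refine hv (funext fun i => IsFractionRing.injective R K ?_)
  simpa using Fintype.linearIndependent_iff.mp hQ _ hsum i

theorem linearIndependent_genericForm_comp {N ι : Type*} [AddCommGroup N] [Module R N]
    {ψ : Dual R N} (hψ : ∃ g, ∃ a ≠ (0 : R), ∀ t, ψ t • g = a • t) {P : ι → M →ₗ[R] N}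
    (hP : LinearIndependent R P) : LinearIndependent K fun i => genericForm K (ψ ∘ₗ P i) := by
  obtain ⟨g, a, ha, hψ⟩ := hψ
  have hψP : LinearIndependent R fun i => ψ ∘ₗ P i := by
    rw [linearIndependent_iff'] at hP ⊢
    intro s c hc i hi
    refine (mul_eq_zero.mp (hP s (fun i => a * c i) (LinearMap.ext fun u => ?_) i hi)).resolve_left
      ha
    have hu : ψ (∑ i ∈ s, c i • P i u) = 0 := by simpa using LinearMap.congr_fun hc u
    simpa [mul_smul, ← Finset.smul_sum, hu] using (hψ (∑ i ∈ s, c i • P i u)).symm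
  rw [← LinearIndependent.iff_fractionRing (R := R)]
  exact hψP.map' ((Algebra.linearMap R K).compRight R) (LinearMap.ker_eq_bot.mpr fun _ _ =>
    (LinearMap.cancel_left (IsFractionRing.injective R K)).mp)

end IntegralForms

theorem exists_finset_linearIndependent_sumElim {k V ι κ : Type*} [DivisionRing k] [AddCommGroup V]
    [Module k V] [FiniteDimensional k V] [Fintype ι] {L : ι → V} (hL : LinearIndependent k L)
    {Q : κ → V} (hQ : Submodule.span k (Set.range Q) = ⊤) :
    ∃ T : Finset κ, Fintype.card ι + T.card = finrank k V ∧
      LinearIndependent k (Sum.elim L fun i : T => Q i) := by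
  let U := Submodule.span k (Set.range L)
  obtain ⟨T, -, -, hspan, hT⟩ :=
    exists_linearIndepOn_extension (linearIndepOn_empty k (U.mkQ ∘ Q)) (Set.empty_subset Set.univ)
  have hspanT : ⊤ ≤ Submodule.span k (Set.range fun i : T => U.mkQ (Q i)) := by
    rw [Set.image_univ, ← Submodule.span_le, Set.range_comp, Submodule.span_image, hQ,
      Submodule.map_top, Submodule.range_mkQ] at hspan
    rwa [Set.image_eq_range] at hspan
  lift T to Finset κ using Set.finite_coe_iff.mp (Module.Finite.finite_basis (Basis.mk hT hspanT))
  refine ⟨T, ?_, LinearIndependent.sumElim_of_quotient (M' := U)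
    (f := fun i => ⟨L i, Submodule.subset_span ⟨i, rfl⟩⟩) (.of_comp U.subtype hL) _ hT⟩
  rw [← U.finrank_quotient_add_finrank, finrank_span_eq_card hL,
    finrank_eq_card_basis (Basis.mk hT hspanT), add_comm]
  exact congrArg (· + _) (Fintype.card_coe T).symm

section Powers

variable {R M A : Type*} [CommRing R] [AddCommGroup M] [Module R M] [CommRing A] [Algebra R A]

/-- The linear map `M^{⊗ n} → A`, `u₁ ⊗ ⋯ ⊗ uₙ ↦ ∏ ℓ uᵢ`, induced by `ℓ : M → A`. -/
noncomputable def tensorLift (ℓ : M →ₗ[R] A) (n : ℕ) : ⨂[R]^n M →ₗ[R] A :=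
  PiTensorProduct.lift ((MultilinearMap.mkPiAlgebra R (Fin n) A).compLinearMap fun _ => ℓ)

theorem tensorLift_tprod (ℓ : M →ₗ[R] A) {n : ℕ} (u : Fin n → M) :
    tensorLift ℓ n (PiTensorProduct.tprod R u) = ∏ i, ℓ (u i) := by
  simp [tensorLift]

theorem tensorLift_smul_tprod_const {ψ : Dual R M} {g : M} {a : R} (hψ : ∀ u, ψ u • g = a • u)
    (n : ℕ) (t : ⨂[R]^n M) :
    tensorLift ψ n t • PiTensorProduct.tprod R (fun _ : Fin n => g) = a ^ n • t := by
  induction t using PiTensorProduct.induction_on with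
  | smul_tprod r u =>
    rw [map_smul, smul_assoc, smul_comm _ r, tensorLift_tprod, ← MultilinearMap.map_smul_univ]
    simp_rw [hψ]
    rw [MultilinearMap.map_smul_univ, Fin.prod_const]
  | add u v hu hv => rw [map_add, add_smul, hu, hv, smul_add]

end Powers

section SymmetricPower

variable {R : Type} [CommRing R] {M : Type*} [AddCommGroup M] [Module R M]
variable {A : Type*} [CommRing A] [Algebra R A]

/-- The linear map `Symⁿ M → A`, `u₁ ⋯ uₙ ↦ ∏ ℓ uᵢ`, induced by `ℓ : M → A`. -/
noncomputable def symLift (ℓ : M →ₗ[R] A) (n : ℕ) : Sym[R]^n M →ₗ[R] A :=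
  let g : Sym[R]^n M →+ A :=
    AddCon.lift _ (tensorLift ℓ n).toAddMonoidHom (AddCon.addConGen_le.mpr (by
      rintro _ _ ⟨π, u⟩
      change tensorLift ℓ n (PiTensorProduct.tprod R u) =
        tensorLift ℓ n (PiTensorProduct.tprod R fun i => u (π i))
      rw [tensorLift_tprod, tensorLift_tprod]
      exact (Equiv.prod_comp π fun i => ℓ (u i)).symm))
  { g with
    map_smul' := fun r s => by
      induction s using AddCon.induction_on with
      | _ t => exact map_smul (tensorLift ℓ n) r t }

theorem symLift_tprod (ℓ : M →ₗ[R] A) {n : ℕ} (u : Fin n → M) :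
    symLift ℓ n (SymmetricPower.tprod R u) = ∏ i, ℓ (u i) :=
  tensorLift_tprod ℓ u

instance finite_symmetricPower [Module.Finite R M] (n : ℕ) : Module.Finite R (Sym[R]^n M) :=
  Module.Finite.of_surjective (SymmetricPower.mk R (Fin n) M)
    (LinearMap.range_eq_top.mp (SymmetricPower.range_mk R (Fin n) M))

end SymmetricPower

theorem exists_dual_smul_eq_smul (R M : Type*) [CommRing R] [IsDomain R] [AddCommGroup M]
    [Module R M] [Module.Invertible R M] :
    ∃ (ψ : Dual R M) (g : M) (a : R), a ≠ 0 ∧ ∀ u, ψ u • g = a • u := by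
  obtain ⟨ψ, g, hne⟩ : ∃ (ψ : Dual R M) (g : M), ψ g ≠ 0 := by
    by_contra! hzero
    have hcontract : contractLeft R M = 0 := TensorProduct.ext' fun ψ g => by simpa using hzero ψ g
    obtain ⟨t, ht⟩ := (Module.Invertible.linearEquiv R M).surjective 1
    exact one_ne_zero (ht.symm.trans (LinearMap.congr_fun hcontract t))
  obtain ⟨a, ha⟩ := (Module.Invertible.toModuleEnd_bijective R M).2 (ψ.smulRight g)
  have hψ : ∀ u, ψ u • g = a • u := fun u => (LinearMap.congr_fun ha u).symm
  refine ⟨ψ, g, a, ?_, hψ⟩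
  rintro rfl
  have hsq := congrArg ψ (hψ g)
  rw [zero_smul, map_zero, map_smul, smul_eq_mul] at hsq
  exact hne (mul_self_eq_zero.mp hsq)

section Forms

variable {K : Type} [Field K] (σ : K →+* ℂ)
variable {E : Type*} [AddCommGroup E] [Module (𝓞 K) E]

theorem toCx_eq_genericToCx (u : E) : toCx σ u = genericToCx σ E (1 ⊗ₜ[𝓞 K] u) := by
  rw [genericToCx_tmul, map_one, one_smul]

theorem span_range_toCx : Submodule.span ℂ (Set.range (toCx σ : E → Cx σ E)) = ⊤ := by
  refine eq_top_iff.mpr fun u _ => ?_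
  induction u using Cx.induction with
  | h0 => exact zero_mem _
  | hs z e => exact Submodule.smul_mem _ _ (Submodule.subset_span ⟨e, rfl⟩)
  | ha u v hu hv => exact add_mem (hu trivial) (hv trivial)

theorem exists_eq_sum_smul_toCx {J : Type*} [Fintype J] (b : Basis J K (K ⊗[𝓞 K] E)) {e : J → E}
    (hb : ∀ j, b j = 1 ⊗ₜ[𝓞 K] e j) (u : Cx σ E) :
    ∃ w : J → ℂ, u = ∑ j, w j • toCx σ (e j) := by
  induction u using Cx.induction with
  | h0 => exact ⟨0, by simp⟩
  | hs z u =>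
    refine ⟨fun j => z * σ (b.repr (1 ⊗ₜ u) j), ?_⟩
    rw [toCx_eq_genericToCx]
    conv_lhs => rw [← b.sum_repr (1 ⊗ₜ u)]
    simp only [map_sum, Finset.smul_sum, mul_smul, LinearMap.map_smulₛₗ, hb, toCx_eq_genericToCx]
  | ha u v hu hv =>
    obtain ⟨w, rfl⟩ := hu
    obtain ⟨w', rfl⟩ := hv
    exact ⟨w + w', by simp [add_smul, Finset.sum_add_distrib]⟩

/-- The complexification `E_σ → ℂ` of a linear form `E → K`. -/
noncomputable def formCx (Ψ : E →ₗ[𝓞 K] K) : Cx σ E →ₗ[ℂ] ℂ :=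
  liftCx σ
    { toFun := fun u => σ (Ψ u)
      map_add' := fun u v => by simp
      map_smul' := fun r u => by
        rw [map_smul, Algebra.smul_def, map_mul]; rfl }

theorem formCx_toCx (Ψ : E →ₗ[𝓞 K] K) (u : E) : formCx σ Ψ (toCx σ u) = σ (Ψ u) :=
  liftCx_toCx σ _ u

theorem formCx_smul (a : K) (Ψ : E →ₗ[𝓞 K] K) : formCx σ (a • Ψ) = σ a • formCx σ Ψ :=
  Cx.ext σ fun u => by simp [formCx_toCx]

theorem formCx_genericToCx (Ψ : E →ₗ[𝓞 K] K) (u : K ⊗[𝓞 K] E) :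
    formCx σ Ψ (genericToCx σ E u) = σ (Ψ.liftBaseChange K u) := by
  induction u using TensorProduct.induction_on with
  | zero => simp
  | tmul k e => rw [genericToCx_tmul, map_smul, formCx_toCx]; simp
  | add u v hu hv => rw [map_add, map_add, hu, hv, map_add, map_add]

theorem formCx_genericForm_comp {F : Type*} [AddCommGroup F] [Module (𝓞 K) F]
    (ψ : Dual (𝓞 K) F) (P : E →ₗ[𝓞 K] F) :
    formCx σ (genericForm K (ψ ∘ₗ P)) = formCx σ (genericForm K ψ) ∘ₗ mapCx σ P :=
  Cx.ext σ fun u => by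
    simp only [LinearMap.comp_apply, mapCx_toCx, formCx_toCx, genericForm_apply]

theorem tensorForm_multiCx {n : ℕ} (φ : Fin n → (Cx σ E →ₗ[ℂ] ℂ)) (u : Fin n → Cx σ E) :
    tensorForm σ φ (multiCx σ n (PiTensorProduct.tprod (𝓞 K)) u) = ∏ i, φ i (u i) := by
  have : (tensorForm σ φ).compMultilinearMap (multiCx σ n (PiTensorProduct.tprod (𝓞 K))) =
      (MultilinearMap.mkPiAlgebra ℂ (Fin n) ℂ).compLinearMap φ := by
    refine MultilinearMap.ext_of_span_eq_top (g := fun _ => (toCx σ : E → Cx σ E))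
      (fun _ => span_range_toCx σ) fun j => ?_
    simp only [LinearMap.compMultilinearMap_apply, MultilinearMap.compLinearMap_apply,
      MultilinearMap.mkPiAlgebra_apply, multiCx_toCx, tensorForm_tprod]
  exact DFunLike.congr_fun this u

theorem formCx_genericForm_tensorLift (ψ : Dual (𝓞 K) E) (n : ℕ) :
    formCx σ (genericForm K (tensorLift ψ n)) =
      tensorForm σ fun _ : Fin n => formCx σ (genericForm K ψ) := by
  refine Cx.ext σ fun t => ?_
  induction t using PiTensorProduct.induction_on with
  | smul_tprod r u =>
    rw [(toCx σ).map_smulₛₗ, map_smul, map_smul, tensorForm_tprod, formCx_toCx, genericForm_apply,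
      tensorLift_tprod]
    simp only [formCx_toCx, genericForm_apply, map_prod]
  | add u v hu hv => simp only [map_add, hu, hv]

theorem minSubspace_eq_top {f : Cx σ E}
    (h : ∀ Ψ : E →ₗ[𝓞 K] K, formCx σ Ψ f = 0 → Ψ = 0) : minSubspace σ f = ⊤ := by
  rw [minSubspace, sInf_eq_top]
  intro W hW
  by_contra hne
  obtain ⟨φ, hφ, hφW⟩ := W.exists_le_ker_of_lt_top (lt_top_iff_ne_top.mpr hne)
  obtain ⟨Ψ, rfl⟩ := (LinearMap.liftBaseChangeEquiv (R := 𝓞 K) (M := E) K).surjective φ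
  have hker : subspaceCx σ W ≤ LinearMap.ker (formCx σ Ψ) := by
    refine Submodule.span_le.mpr ?_
    rintro _ ⟨v, hv, rfl⟩
    exact (formCx_genericToCx σ Ψ v).trans ((congrArg σ (hφW hv)).trans (map_zero σ))
  exact hφ (by rw [h Ψ (hker hW), map_zero])

end Forms

section Norms

variable {K : Type} [Field K] {σ : K →+* ℂ}
variable {E : Type*} [AddCommGroup E] [Module (𝓞 K) E]

theorem Metric.norm_nonneg (h : Metric K E) (u : Cx σ E) : 0 ≤ h.norm σ u := Real.sqrt_nonneg _

variable [Module.Finite (𝓞 K) E]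

theorem Metric.exists_norm_le (h : Metric K E) {W : Type*} [NormedAddCommGroup W] [NormedSpace ℂ W]
    (φ : Cx σ E →ₗ[ℂ] W) : ∃ c : ℝ, 0 ≤ c ∧ ∀ u, ‖φ u‖ ≤ c * h.norm σ u := by
  let : NormedAddCommGroup (Cx σ E) := (h.core σ).toNormedAddCommGroup
  let : InnerProductSpace ℂ (Cx σ E) := InnerProductSpace.ofCore (h.core σ).toCore
  let g := LinearMap.toContinuousLinearMap φ
  exact ⟨‖g‖, g.opNorm_nonneg, g.le_opNorm⟩

theorem norm_mapCx_le {F : Type*} [AddCommGroup F] [Module (𝓞 K) F] (hE : Metric K E)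
    (hF : Metric K F) (φ : E →ₗ[𝓞 K] F) (u : Cx σ E) :
    hF.norm σ (mapCx σ φ u) ≤ homNorm hE hF σ φ * hE.norm σ u := by
  let : NormedAddCommGroup (Cx σ F) := (hF.core σ).toNormedAddCommGroup
  let : InnerProductSpace ℂ (Cx σ F) := InnerProductSpace.ofCore (hF.core σ).toCore
  obtain ⟨c₀, hc₀, hle⟩ := hE.exists_norm_le (mapCx σ φ)
  rcases (hE.norm_nonneg u).eq_or_lt with h0 | hpos
  · have hu : hF.norm σ (mapCx σ φ u) ≤ c₀ * hE.norm σ u := hle u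
    simpa [← h0] using hu
  · rw [← div_le_iff₀ hpos]
    exact le_csInf ⟨c₀, hc₀, hle⟩ fun c hc => (div_le_iff₀ hpos).mpr (hc.2 u)

theorem Metric.norm_tensorPower (h : Metric K E) (n : ℕ) (t : Cx σ (⨂[𝓞 K]^n E)) :
    (h.tensorPower n).norm σ t = √(∑ I, ‖h.tensorCoord σ n I t‖ ^ 2) := by
  unfold Metric.norm
  congr 1
  change (coordForm (h.tensorCoord σ n) t t).re = _
  simp only [coordForm, LinearMap.mk₂'ₛₗ_apply, Complex.re_sum]
  refine Finset.sum_congr rfl fun I _ => ?_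
  rw [← Complex.normSq_eq_conj_mul_self, Complex.ofReal_re, Complex.normSq_eq_norm_sq]

/-- The norm on the dual of `E_σ` that is dual to the hermitian norm, computed in an orthonormal
basis. -/
noncomputable def Metric.dualNorm (h : Metric K E) (σ : K →+* ℂ) (φ : Cx σ E →ₗ[ℂ] ℂ) : ℝ :=
  √(∑ k, ‖φ ((h.exists_orthonormal σ).choose k)‖ ^ 2)

theorem Metric.norm_tensorForm_le (h : Metric K E) {n : ℕ} (φ : Fin n → (Cx σ E →ₗ[ℂ] ℂ))
    (t : Cx σ (⨂[𝓞 K]^n E)) :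
    ‖tensorForm σ φ t‖ ≤ (∏ j, h.dualNorm σ (φ j)) * (h.tensorPower n).norm σ t := by
  set e := (h.exists_orthonormal σ).choose with he
  have hdual : ∏ j, h.dualNorm σ (φ j) = √(∑ I : Fin n → _, (∏ j, ‖φ j (e (I j))‖) ^ 2) := by
    simp_rw [Metric.dualNorm, ← Finset.prod_pow, ← he]
    rw [← Real.sqrt_prod _ fun _ _ => by positivity, Finset.prod_univ_sum, Fintype.piFinset_univ]
  calc ‖tensorForm σ φ t‖ = ‖∑ I, h.tensorCoord σ n I t * ∏ j, φ j (e (I j))‖ := by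
        conv_lhs => rw [h.tensorCoord_expand σ n t]
        simp only [map_sum, map_smul, smul_eq_mul, tensorForm_multiCx, he]
    _ ≤ ∑ I, (∏ j, ‖φ j (e (I j))‖) * ‖h.tensorCoord σ n I t‖ := by
        refine (norm_sum_le _ _).trans_eq (Finset.sum_congr rfl fun I _ => ?_)
        rw [norm_mul, norm_prod, mul_comm]
    _ ≤ _ := by
        rw [hdual, h.norm_tensorPower]
        exact Real.sum_mul_le_sqrt_mul_sqrt _ _ _

end Norms

section ExponentialBounds

variable {K : Type} [Field K] [NumberField K]
variable {E : Type*} [AddCommGroup E] [Module (𝓞 K) E]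

theorem Metric.exists_norm_formCx_le_exp [Module.Finite (𝓞 K) E] (h : Metric K E) {ι : Type*}
    [Finite ι] (L : ι → E →ₗ[𝓞 K] K) :
    ∃ b : ℝ, ∀ (τ : K →+* ℂ) i (u : Cx τ E), ‖formCx τ (L i) u‖ ≤ Real.exp b * h.norm τ u := by
  choose c _ hc using fun p : (K →+* ℂ) × ι => h.exists_norm_le (formCx p.1 (L p.2))
  obtain ⟨b, hb⟩ := Finite.exists_le c
  refine ⟨b, fun τ i u => (hc (τ, i) u).trans ?_⟩
  have hexp : c (τ, i) ≤ Real.exp b := by linarith [hb (τ, i), Real.add_one_le_exp b]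
  exact mul_le_mul_of_nonneg_right hexp (h.norm_nonneg u)

variable {H : Type*} [AddCommGroup H] [Module (𝓞 K) H] [Module.Invertible (𝓞 K) H]

theorem Metric.exists_linearIndependent_norm_formCx_le (hH : Metric K H) :
    ∃ γ : ℝ, ∀ (x : ℕ) {ι : Type*} (P : ι → E →ₗ[𝓞 K] ⨂[𝓞 K]^x H), LinearIndependent (𝓞 K) P →
      ∃ Q : ι → Dual (𝓞 K) E, LinearIndependent K (fun i => genericForm K (Q i)) ∧
        ∀ (τ : K →+* ℂ) i (u : Cx τ E), ‖formCx τ (genericForm K (Q i)) u‖ ≤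
          Real.exp (γ * x) * (hH.tensorPower x).norm τ (mapCx τ (P i) u) := by
  obtain ⟨ψ, g, a, ha, hψ⟩ := exists_dual_smul_eq_smul (𝓞 K) H
  obtain ⟨γ, hγ⟩ := Finite.exists_le fun τ : K →+* ℂ => hH.dualNorm τ (formCx τ (genericForm K ψ))
  refine ⟨γ, fun x ι P hP => ⟨fun i => tensorLift ψ x ∘ₗ P i, linearIndependent_genericForm_comp
    ⟨_, _, pow_ne_zero x ha, tensorLift_smul_tprod_const hψ x⟩ hP, fun τ i u => ?_⟩⟩
  rw [formCx_genericForm_comp, formCx_genericForm_tensorLift, mul_comm γ, Real.exp_nat_mul]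
  refine (hH.norm_tensorForm_le _ _).trans (mul_le_mul_of_nonneg_right ?_ (Metric.norm_nonneg _ _))
  rw [Fin.prod_const]
  have hexp : hH.dualNorm τ (formCx τ (genericForm K ψ)) ≤ Real.exp γ := by
    linarith [hγ τ, Real.add_one_le_exp γ]
  exact pow_le_pow_left₀ (Real.sqrt_nonneg _) hexp x

end ExponentialBounds

section Determinant

theorem norm_det_le_of_col {J : Type*} [Fintype J] [DecidableEq J] {A : Matrix J J ℂ} {β : J → ℝ}
    {ε : ℝ} {j₀ : J} (h : ∀ i j, j ≠ j₀ → ‖A i j‖ ≤ β i) (h₀ : ∀ i, ‖A i j₀‖ ≤ β i * ε) :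
    ‖A.det‖ ≤ (Fintype.card J).factorial * (∏ i, β i) * ε := by
  have hterm (π : Equiv.Perm J) : ‖Equiv.Perm.sign π • ∏ i, A (π i) i‖ ≤ (∏ i, β i) * ε :=
    calc ‖Equiv.Perm.sign π • ∏ i, A (π i) i‖ = ∏ i, ‖A (π i) i‖ := by
          rw [← norm_prod]
          rcases Int.units_eq_one_or (Equiv.Perm.sign π) with hs | hs <;> simp [hs]
      _ ≤ ∏ i, (β (π i) * if i = j₀ then ε else 1) := by
          refine Finset.prod_le_prod (fun i _ => norm_nonneg _) fun i _ => ?_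
          split_ifs with hi
          · rw [hi]; exact h₀ _
          · rw [mul_one]; exact h _ _ hi
      _ = (∏ i, β i) * ε := by
          rw [Finset.prod_mul_distrib, Equiv.prod_comp π β, Finset.prod_ite_eq' Finset.univ j₀,
            if_pos (Finset.mem_univ j₀)]
  rw [Matrix.det_apply]
  refine (norm_sum_le _ _).trans ((Finset.sum_le_sum fun π _ => hterm π).trans_eq ?_)
  rw [Finset.sum_const, Finset.card_univ, Fintype.card_perm, nsmul_eq_mul, mul_assoc]

variable {K : Type} [Field K] [NumberField K]

theorem one_le_prod_norm_embeddings {Δ : 𝓞 K} (h : Δ ≠ 0) :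
    1 ≤ ∏ τ : K →+* ℂ, ‖τ (Δ : K)‖ := by
  have hnorm : ∏ τ : K →+* ℂ, ‖τ (Δ : K)‖ = |((Algebra.norm ℤ Δ : ℤ) : ℝ)| := by
    have := congr_arg (‖·‖) (Algebra.norm_eq_prod_embeddings ℚ ℂ (Δ : K))
    rw [norm_prod, ← Fintype.prod_equiv (RingHom.equivRatAlgHom K ℂ) (fun f => ‖f (Δ : K)‖)
      (fun φ => ‖φ (Δ : K)‖) fun _ => by simp [RingHom.equivRatAlgHom_apply]] at this
    rw [← this, ← Algebra.coe_norm_int]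
    simp
  rw [hnorm, ← Int.cast_abs]
  exact_mod_cast Int.one_le_abs (Algebra.norm_ne_zero_iff.mpr h)

theorem norm_le_of_det_ne_zero (σ : K →+* ℂ) {J : Type*} [Fintype J] [DecidableEq J]
    {A : Matrix J J (𝓞 K)} (hA : A.det ≠ 0) {w : J → ℂ} {β : J → ℝ} {ε : ℝ} (hε : 0 ≤ ε)
    (h : ∀ (τ : K →+* ℂ) i j, ‖τ (A i j : K)‖ ≤ β i)
    (hw : ∀ i, ‖∑ j, w j * σ (A i j : K)‖ ≤ β i * ε) (j₀ : J) :
    ‖w j₀‖ ≤ ((Fintype.card J).factorial * ∏ i, β i) ^ finrank ℚ K * ε := by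
  classical
  set B : ℝ := (Fintype.card J).factorial * ∏ i, β i
  have hdet (τ : K →+* ℂ) : τ (A.det : K) = (A.map (emb τ)).det := RingHom.map_det (emb τ) A
  have hB (τ : K →+* ℂ) : ‖τ (A.det : K)‖ ≤ B := by
    simpa [hdet] using norm_det_le_of_col (A := A.map (emb τ)) (ε := 1) (fun i j _ => h τ i j)
      (fun i => (h τ i j₀).trans_eq (mul_one _).symm)
  -- Cramer's rule: replacing column `j₀` by `A w` multiplies the determinant by `w j₀`.
  have hBε : ‖w j₀‖ * ‖σ (A.det : K)‖ ≤ B * ε := by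
    rw [hdet, ← norm_mul, ← smul_eq_mul, ← Matrix.det_updateCol_sum (A.map (emb σ)) j₀ w]
    refine norm_det_le_of_col (j₀ := j₀) (fun i j hj => ?_) fun i => ?_
    · rw [Matrix.updateCol_ne hj]; exact h σ i j
    · rw [Matrix.updateCol_self]; exact hw i
  calc ‖w j₀‖ ≤ ‖w j₀‖ * ∏ τ : K →+* ℂ, ‖τ (A.det : K)‖ :=
        le_mul_of_one_le_right (norm_nonneg _) (one_le_prod_norm_embeddings hA)
    _ = (‖w j₀‖ * ‖σ (A.det : K)‖) * ∏ τ ∈ Finset.univ.erase σ, ‖τ (A.det : K)‖ := by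
        rw [mul_assoc, Finset.mul_prod_erase _ (fun τ : K →+* ℂ => ‖τ (A.det : K)‖)
          (Finset.mem_univ σ)]
    _ ≤ (B * ε) * ∏ _τ ∈ Finset.univ.erase σ, B :=
        mul_le_mul hBε (Finset.prod_le_prod (fun _ _ => norm_nonneg _) fun τ _ => hB τ)
          (Finset.prod_nonneg fun _ _ => norm_nonneg _)
          (mul_nonneg ((norm_nonneg _).trans (hB σ)) hε)
    _ = (∏ _τ : K →+* ℂ, B) * ε := by
        rw [← Finset.mul_prod_erase _ (fun _ => B) (Finset.mem_univ σ), mul_right_comm]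
    _ = B ^ finrank ℚ K * ε := by
        rw [Finset.prod_const, Finset.card_univ, NumberField.Embeddings.card K ℂ]

end Determinant

section IndependenceCriterion

variable {K : Type} [Field K] [NumberField K] {σ : K →+* ℂ}
variable {E : Type*} [AddCommGroup E] [Module (𝓞 K) E] [Module.Finite (𝓞 K) E]

theorem Metric.exists_le_of_linearIndependent (hE : Metric K E) {f : Cx σ E} (hf : f ≠ 0) :
    ∃ C : ℝ, ∀ {J : Type*} [Fintype J] (Q : J → Dual (𝓞 K) E) (β : J → ℝ) (δ : ℝ),
      Fintype.card J = finrank (𝓞 K) E → LinearIndependent K (fun i => genericForm K (Q i)) →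
      (∀ (τ : K →+* ℂ) i (u : Cx τ E),
        ‖formCx τ (genericForm K (Q i)) u‖ ≤ Real.exp (β i) * hE.norm τ u) →
      (∀ i, ‖formCx σ (genericForm K (Q i)) f‖ ≤ Real.exp (β i + δ)) →
      C ≤ finrank ℚ K * ∑ i, β i + δ := by
  set m := finrank (𝓞 K) E
  obtain ⟨b, e, hb⟩ := exists_basis_eq_one_tmul (R := 𝓞 K) K E
  obtain ⟨w, hw⟩ := exists_eq_sum_smul_toCx σ b hb f
  obtain ⟨j₀, hj₀⟩ : ∃ j₀, w j₀ ≠ 0 := by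
    by_contra! hw0
    exact hf (by simp [hw, hw0])
  obtain ⟨M, hM⟩ := Finite.exists_le fun p : (K →+* ℂ) × Fin m => hE.norm p.1 (toCx p.1 (e p.2))
  have hMexp (τ : K →+* ℂ) (j : Fin m) : hE.norm τ (toCx τ (e j)) ≤ Real.exp |M| := by
    linarith [hM (τ, j), Real.add_one_le_exp |M|, le_abs_self M]
  refine ⟨Real.log ‖w j₀‖ - finrank ℚ K * (Real.log m.factorial + m * |M|),
    fun {J} _ Q β δ hJ hQ hβ hδ => ?_⟩
  let φ : Fin m ≃ J := (Fintype.equivFinOfCardEq hJ).symm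
  have hentry (τ : K →+* ℂ) (i j) : ‖τ (Q i (e j) : K)‖ ≤ Real.exp (β i + |M|) := by
    have hQe := hβ τ i (toCx τ (e j))
    rw [formCx_toCx] at hQe
    rw [Real.exp_add]
    exact hQe.trans (mul_le_mul_of_nonneg_left (hMexp τ j) (Real.exp_pos _).le)
  have hcol (i) : ‖∑ j, w j * σ (Q i (e j) : K)‖ ≤ Real.exp (β i + |M|) * Real.exp δ := by
    have hQf : formCx σ (genericForm K (Q i)) f = ∑ j, w j * σ (Q i (e j) : K) := by
      simp [hw, formCx_toCx, genericForm_apply]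
    rw [← hQf, ← Real.exp_add]
    refine (hδ i).trans (Real.exp_le_exp.mpr ?_)
    linarith [abs_nonneg M]
  have hw₀ := norm_le_of_det_ne_zero σ (det_ne_zero_of_linearIndependent_forms b hb
    (hQ.comp φ φ.injective)) (Real.exp_pos δ).le (fun τ i => hentry τ (φ i))
    (fun i => hcol (φ i)) j₀
  rw [Fintype.card_fin] at hw₀
  have hlog := Real.log_le_log (norm_pos_iff.mpr hj₀) hw₀
  rw [Real.log_mul (by positivity) (by positivity), Real.log_exp, Real.log_pow,
    Real.log_mul (by positivity) (by positivity), ← Real.exp_sum, Real.log_exp,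
    Finset.sum_add_distrib, Equiv.sum_comp φ β, Fin.sum_const, nsmul_eq_mul] at hlog
  linarith

theorem nonneg_of_eventually_le_mul_log {A B C : ℝ}
    (h : ∀ᶠ x : ℕ in atTop, C ≤ A * (x * Real.log x) + B * x) : 0 ≤ A := by
  have hlog : Tendsto (fun x : ℕ => Real.log x) atTop atTop :=
    Real.tendsto_log_atTop.comp tendsto_natCast_atTop_atTop
  have hlim : Tendsto (fun x : ℕ => A + (B - C * (x : ℝ)⁻¹) * (Real.log x)⁻¹) atTop
      (nhds (A + (B - C * 0) * 0)) :=
    tendsto_const_nhds.add ((tendsto_const_nhds.sub (tendsto_const_nhds.mul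
      (tendsto_inv_atTop_zero.comp tendsto_natCast_atTop_atTop))).mul
      (tendsto_inv_atTop_zero.comp hlog))
  rw [mul_zero, add_zero] at hlim
  refine ge_of_tendsto hlim ?_
  filter_upwards [h, eventually_gt_atTop 0, hlog.eventually_gt_atTop 0] with x hx hx0 hlogx
  have : (0 : ℝ) < x := Nat.cast_pos.mpr hx0
  have hdiv : A + (B - C * (x : ℝ)⁻¹) * (Real.log x)⁻¹ =
      (A * (x * Real.log x) + B * x - C) / (x * Real.log x) := by
    field_simp
    ring
  rw [hdiv]
  exact div_nonneg (sub_nonneg.mpr hx) (by positivity)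

variable {H : Type*} [AddCommGroup H] [Module (𝓞 K) H] [Module.Invertible (𝓞 K) H]
variable {hE : Metric K E} {hH : Metric K H} {f : Cx σ E} {c₁ c₂ c₃ b₁ b₂ : ℝ}

theorem SmallForms.eventually_exists_dual (h : SmallForms hE hH σ f c₁ c₂ c₃ b₁ b₂) :
    ∃ b b' : ℝ, ∀ᶠ x : ℕ in atTop, ∃ Q : Fin (finrank (𝓞 K) E) → Dual (𝓞 K) E,
      LinearIndependent K (fun i => genericForm K (Q i)) ∧
      (∀ (τ : K →+* ℂ) i (u : Cx τ E), ‖formCx τ (genericForm K (Q i)) u‖ ≤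
        Real.exp (c₁ * (x * Real.log x) + b * x) * hE.norm τ u) ∧
      ∀ i, ‖formCx σ (genericForm K (Q i)) f‖ ≤ Real.exp (c₁ * (x * Real.log x) + b * x +
        ((c₃ - c₂ * finrank (𝓞 K) E) * (x * Real.log x) + b' * x)) := by
  obtain ⟨γ, hγ⟩ := hH.exists_linearIndependent_norm_formCx_le (E := E)
  refine ⟨γ + b₁, b₂ - b₁, Eventually.mono h fun x ⟨P, hP, hP_norm, hP_f⟩ => ?_⟩
  obtain ⟨Q, hQ, hQP⟩ := hγ x P hP
  refine ⟨Q, hQ, fun τ i u => (hQP τ i u).trans ?_, fun i => (hQP σ i f).trans ?_⟩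
  · calc Real.exp (γ * x) * (hH.tensorPower x).norm τ (mapCx τ (P i) u)
        ≤ Real.exp (γ * x) * (Real.exp (c₁ * x * Real.log x + b₁ * x) * hE.norm τ u) := by
          gcongr
          exact (norm_mapCx_le hE _ _ u).trans
            (mul_le_mul_of_nonneg_right (hP_norm i τ) (hE.norm_nonneg u))
      _ = _ := by rw [← mul_assoc, ← Real.exp_add]; ring_nf
  · refine (mul_le_mul_of_nonneg_left (hP_f i) (Real.exp_pos _).le).trans_eq ?_
    rw [← Real.exp_add]
    ring_nf

theorem SmallForms.mul_finrank_le (h : SmallForms hE hH σ f c₁ c₂ c₃ b₁ b₂) (hf : f ≠ 0)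
    {ι : Type*} [Fintype ι] {L : ι → E →ₗ[𝓞 K] K} (hL : LinearIndependent K L)
    (hLf : ∀ i, formCx σ (L i) f = 0) :
    c₂ * finrank (𝓞 K) E ≤ finrank ℚ K * (finrank (𝓞 K) E - Fintype.card ι) * c₁ + c₃ := by
  classical
  set m := finrank (𝓞 K) E
  obtain ⟨C, hC⟩ := hE.exists_le_of_linearIndependent hf
  obtain ⟨a, Q₀, ha, hQ₀⟩ := exists_genericForm_eq_smul L
  obtain ⟨b₀, hb₀⟩ := hE.exists_norm_formCx_le_exp fun i => genericForm K (Q₀ i)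
  have hQ₀_ind : LinearIndependent K fun i => genericForm K (Q₀ i) := by
    simp_rw [hQ₀]
    exact hL.units_smul fun _ => Units.mk0 (algebraMap (𝓞 K) K a) (by simpa using ha)
  have hQ₀f (i : ι) : formCx σ (genericForm K (Q₀ i)) f = 0 := by
    rw [hQ₀, formCx_smul, LinearMap.smul_apply, hLf, smul_zero]
  obtain ⟨b, b', hforms⟩ := h.eventually_exists_dual
  suffices h0 : 0 ≤ finrank ℚ K * (m - Fintype.card ι) * c₁ + (c₃ - c₂ * m) by linarith
  refine nonneg_of_eventually_le_mul_log (B := finrank ℚ K * (m - Fintype.card ι) * b + b')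
    (C := C - finrank ℚ K * Fintype.card ι * b₀) (hforms.mono fun x ⟨Q, hQ, hQ_norm, hQf⟩ => ?_)
  obtain ⟨T, hcard, hind⟩ := exists_finset_linearIndependent_sumElim hQ₀_ind
    (hQ.span_eq_top_of_card_eq_finrank' (by rw [Fintype.card_fin, finrank_linearMap_fractionRing]))
  rw [finrank_linearMap_fractionRing] at hcard
  have hx := hC (Sum.elim Q₀ fun i : T => Q i)
    (Sum.elim (fun _ => b₀) fun _ => c₁ * (x * Real.log x) + b * x)
    ((c₃ - c₂ * m) * (x * Real.log x) + b' * x) (by simpa using hcard)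
    (by rw [← Function.comp_def (genericForm K), Sum.comp_elim]; exact hind)
    (by rintro τ (i | i) u; exacts [hb₀ τ i u, hQ_norm τ i u])
    (by
      rintro (i | i)
      · rw [Sum.elim_inl, hQ₀f, norm_zero]; exact (Real.exp_pos _).le
      · exact hQf i)
  rw [Fintype.sum_sum_type] at hx
  simp only [Sum.elim_inl, Sum.elim_inr, Finset.sum_const, Finset.card_univ, Fintype.card_coe,
    nsmul_eq_mul] at hx
  have hT : (T.card : ℝ) = m - Fintype.card ι := eq_sub_of_add_eq' (by exact_mod_cast hcard)
  rw [hT] at hx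
  linarith

end IndependenceCriterion

section HomogeneousPolynomials

open MvPolynomial

theorem homogeneousSubmodule_eq_span_range_prod_X (ι k : Type*) [CommSemiring k] (n : ℕ) :
    homogeneousSubmodule ι k n =
      Submodule.span k (Set.range fun I : Fin n → ι => ∏ j, (X (I j) : MvPolynomial ι k)) := by
  rw [← homogeneousSubmodule_one_pow, homogeneousSubmodule_one_eq_span_X, Submodule.span_pow]
  congr 1
  ext p
  rw [Set.mem_pow]
  constructor
  · rintro ⟨f, rfl⟩
    choose I hI using fun i => (f i).2
    exact ⟨I, by simp [hI, List.prod_ofFn]⟩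
  · rintro ⟨I, rfl⟩
    exact ⟨fun i => ⟨X (I i), I i, rfl⟩, by simp [List.prod_ofFn]⟩

instance finite_homogeneousSubmodule (ι k : Type*) [Finite ι] [CommSemiring k] (n : ℕ) :
    Module.Finite k (homogeneousSubmodule ι k n) :=
  Module.Finite.iff_fg.mpr (homogeneousSubmodule_fg ι k n)

theorem finrank_homogeneousSubmodule (ι k : Type*) [Fintype ι] [CommRing k] [Nontrivial k]
    (n : ℕ) : finrank k (homogeneousSubmodule ι k n) = (Fintype.card ι).multichoose n := by
  classical
  have hdegree : {α : ι →₀ ℕ | α.degree = n} = (Finset.univ : Finset ι).finsuppAntidiag n := by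
    ext α
    simp [Finset.mem_finsuppAntidiag, Finsupp.degree_eq_sum]
  rw [homogeneousSubmodule_eq_finsupp_supported, hdegree,
    (AddMonoidAlgebra.supportedEquivFinsupp _).finrank_eq, finrank_finsupp_self]
  simp [Finset.card_finsuppAntidiag_nat_eq_multichoose]

theorem eval₂_mul_left_of_isHomogeneous {ι k S : Type*} [CommSemiring k] [CommSemiring S]
    (σ : k →+* S) {G : MvPolynomial ι k} {n : ℕ} (hG : G.IsHomogeneous n) (c : S) (z : ι → S) :
    G.eval₂ σ (fun i => c * z i) = c ^ n * G.eval₂ σ z := by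
  rw [eval₂_eq, eval₂_eq, Finset.mul_sum]
  refine Finset.sum_congr rfl fun α hα => ?_
  have hdegree : n = ∑ i ∈ α.support, α i := hG.degree_eq_sum_deg_support hα
  simp_rw [mul_pow]
  rw [Finset.prod_mul_distrib, Finset.prod_pow_eq_pow_sum, ← hdegree, mul_left_comm]

theorem exists_perm_comp_eq {ι α : Type*} [Fintype ι] {I J : ι → α}
    (h : ∑ j, Finsupp.single (I j) 1 = ∑ j, Finsupp.single (J j) (1 : ℕ)) :
    ∃ π : Equiv.Perm ι, ∀ i, J (π i) = I i := by
  classical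
  have hfiber : ∀ a, Nonempty ({i // I i = a} ≃ {i // J i = a}) := fun a => by
    refine ⟨Fintype.equivOfCardEq ?_⟩
    have := DFunLike.congr_fun h a
    simpa [Finsupp.finsetSum_apply, Finsupp.single_apply, Fintype.card_subtype] using this
  let φ := fun a => (hfiber a).some
  exact ⟨((Equiv.sigmaFiberEquiv I).symm.trans (Equiv.sigmaCongrRight φ)).trans
    (Equiv.sigmaFiberEquiv J), fun i => (φ (I i) ⟨i, rfl⟩).2⟩

end HomogeneousPolynomials

section IntegralBasis

variable {R K M J : Type*} [CommRing R] [Field K] [Algebra R K] [AddCommGroup M] [Module R M]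
variable (b : Basis J K (K ⊗[R] M)) {e : J → M} (hb : ∀ j, b j = 1 ⊗ₜ[R] e j)

include hb

theorem linearMap_ext_of_integral_basis {N : Type*} [AddCommGroup N] [Module R N] [Module K N]
    [IsScalarTower R K N] {g h : M →ₗ[R] N} (heq : ∀ j, g (e j) = h (e j)) : g = h :=
  (LinearMap.liftBaseChangeEquiv K).injective (b.ext fun j => by simp [hb, heq])

theorem multilinearMap_ext_of_integral_basis {N : Type*} [AddCommGroup N] [Module R N] [Module K N]
    [IsScalarTower R K N] {n : ℕ} {g h : MultilinearMap R (fun _ : Fin n => M) N}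
    (heq : ∀ I : Fin n → J, (g fun j => e (I j)) = h fun j => e (I j)) : g = h := by
  induction n with
  | zero =>
    ext u
    convert heq Fin.elim0
  | succ n ih =>
    have : IsScalarTower R K (MultilinearMap R (fun _ : Fin n => M) N) :=
      ⟨fun r c φ => MultilinearMap.ext fun u => smul_assoc r c (φ u)⟩
    have hcurry : g.curryLeft = h.curryLeft :=
      linearMap_ext_of_integral_basis b hb fun j => ih fun I => by
        rw [MultilinearMap.curryLeft_apply, MultilinearMap.curryLeft_apply]
        convert! heq (Fin.cons j I) using 2 <;> exact (Fin.comp_cons e j I).symm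
    rw [← g.uncurry_curryLeft, hcurry, h.uncurry_curryLeft]

end IntegralBasis

section SymmetricForms

open MvPolynomial

variable {R : Type} [CommRing R] {K M J : Type*} [Field K] [Algebra R K]
variable [AddCommGroup M] [Module R M] [Fintype J]

/-- The polynomial `∑ Ψ (e_{I 1} ⋯ e_{I n}) X_{I 1} ⋯ X_{I n}`, the sum being over all `n`-tuples
`I` of indices, attached to a linear form `Ψ` on `Symⁿ M` and vectors `e_j` of `M`. It is the value
of `Ψ` on the `n`-th power of the generic combination `∑ X_j e_j`. -/
noncomputable def symPoly (e : J → M) (n : ℕ) :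
    (Sym[R]^n M →ₗ[R] K) →ₗ[K] MvPolynomial J K where
  toFun Ψ := ∑ I : Fin n → J, C (Ψ (SymmetricPower.tprod R fun j => e (I j))) * ∏ j, X (I j)
  map_add' Ψ Φ := by simp [add_mul, Finset.sum_add_distrib]
  map_smul' c Ψ := by simp [Finset.smul_sum, MvPolynomial.smul_eq_C_mul, mul_assoc]

theorem isHomogeneous_symPoly (e : J → M) (n : ℕ) (Ψ : Sym[R]^n M →ₗ[R] K) :
    (symPoly e n Ψ).IsHomogeneous n := by
  refine IsHomogeneous.sum _ _ _ fun I _ => IsHomogeneous.C_mul ?_ _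
  simpa using IsHomogeneous.prod Finset.univ (fun j => (X (I j) : MvPolynomial J K))
    (fun _ => 1) fun j _ => isHomogeneous_X K (I j)

theorem coeff_symPoly [DecidableEq J] (e : J → M) (n : ℕ) (Ψ : Sym[R]^n M →ₗ[R] K)
    (I : Fin n → J) :
    coeff (∑ j, Finsupp.single (I j) 1) (symPoly e n Ψ) =
      Fintype.card {I' : Fin n → J //
        ∑ j, Finsupp.single (I' j) 1 = ∑ j, Finsupp.single (I j) (1 : ℕ)} •
        Ψ (SymmetricPower.tprod R fun j => e (I j)) := by
  have hterm : ∀ I' : Fin n → J,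
      coeff (∑ j, Finsupp.single (I j) 1)
        (C (Ψ (SymmetricPower.tprod R fun j => e (I' j))) * ∏ j, X (I' j)) =
      if ∑ j, Finsupp.single (I' j) 1 = ∑ j, Finsupp.single (I j) (1 : ℕ)
        then Ψ (SymmetricPower.tprod R fun j => e (I j)) else 0 := fun I' => by
    rw [show (∏ j, X (I' j) : MvPolynomial J K) = monomial (∑ j, Finsupp.single (I' j) 1) 1 from
      (monomial_sum_one _ _).symm, coeff_C_mul, coeff_monomial, mul_ite, mul_one, mul_zero]
    refine if_ctx_congr Iff.rfl (fun h => ?_) fun _ => rfl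
    obtain ⟨π, hπ⟩ := exists_perm_comp_eq h
    rw [← SymmetricPower.tprod_equiv π fun j => e (I j)]
    simp_rw [hπ]
  change coeff _ (∑ I' : Fin n → J, _) = _
  rw [coeff_sum, Finset.sum_congr rfl fun I' _ => hterm I', ← Finset.sum_filter, Finset.sum_const,
    Fintype.card_subtype]

variable (b : Basis J K (K ⊗[R] M)) {e : J → M} (hb : ∀ j, b j = 1 ⊗ₜ[R] e j)

include hb

theorem symPoly_injective [CharZero K] (n : ℕ) :
    Function.Injective (symPoly (R := R) (K := K) e n) := by
  classical
  rw [injective_iff_map_eq_zero]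
  intro Ψ hΨ
  have hvanish : Ψ.compMultilinearMap (SymmetricPower.tprod R) = 0 :=
    multilinearMap_ext_of_integral_basis b hb fun I => by
      have hcoeff := coeff_symPoly e n Ψ I
      rw [hΨ, coeff_zero, eq_comm, smul_eq_zero] at hcoeff
      exact hcoeff.resolve_left (Fintype.card_pos_iff.mpr ⟨⟨I, rfl⟩⟩).ne'
  refine LinearMap.ext_on (SymmetricPower.span_tprod_eq_top R (Fin n) M) ?_
  rintro _ ⟨u, rfl⟩
  exact DFunLike.congr_fun hvanish u

theorem multichoose_le_finrank_symmetricPower [IsFractionRing R K] [Module.Finite R M] (n : ℕ) :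
    (Fintype.card J).multichoose n ≤ finrank R (Sym[R]^n M) := by
  let ℓ : M →ₗ[R] MvPolynomial J K :=
    ((b.constr K fun i => (X i : MvPolynomial J K)).restrictScalars R) ∘ₗ
      TensorProduct.mk R K M 1
  have hℓ : ∀ i, ℓ (e i) = X i := fun i => by
    change b.constr K _ (1 ⊗ₜ[R] e i) = _
    rw [← hb, Basis.constr_basis]
  have hrange : homogeneousSubmodule J K n ≤ LinearMap.range ((symLift ℓ n).liftBaseChange K) := by
    rw [homogeneousSubmodule_eq_span_range_prod_X, Submodule.span_le]
    rintro _ ⟨I, rfl⟩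
    refine ⟨1 ⊗ₜ SymmetricPower.tprod R fun j => e (I j), ?_⟩
    rw [LinearMap.liftBaseChange_one_tmul]
    exact (symLift_tprod ℓ _).trans (Finset.prod_congr rfl fun j _ => hℓ (I j))
  rw [← finrank_homogeneousSubmodule J K n, ← finrank_baseChange_fractionRing K (Sym[R]^n M)]
  exact (Submodule.finrank_mono hrange).trans (LinearMap.finrank_range_le _)

theorem finrank_symmetricPower [CharZero K] [IsFractionRing R K] [Module.Finite R M] (n : ℕ) :
    finrank R (Sym[R]^n M) = (Fintype.card J).multichoose n := by
  refine le_antisymm ?_ (multichoose_le_finrank_symmetricPower b hb n)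
  rw [← finrank_linearMap_fractionRing K, ← finrank_homogeneousSubmodule J K n]
  exact LinearMap.finrank_le_finrank_of_injective
    (f := (symPoly e n).codRestrict _ (isHomogeneous_symPoly e n)) fun Ψ Φ h =>
      symPoly_injective b hb n (congrArg Subtype.val h)

theorem exists_symPoly_eq [CharZero K] [IsFractionRing R K] [Module.Finite R M] {n : ℕ}
    {G : MvPolynomial J K} (hG : G.IsHomogeneous n) :
    ∃ Ψ : Sym[R]^n M →ₗ[R] K, symPoly e n Ψ = G := by
  have hrange : LinearMap.range (symPoly (R := R) e n) = homogeneousSubmodule J K n := by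
    refine Submodule.eq_of_le_of_finrank_eq ?_ ?_
    · rintro _ ⟨Ψ, rfl⟩
      exact isHomogeneous_symPoly e n Ψ
    · rw [LinearMap.finrank_range_of_inj (symPoly_injective b hb n), finrank_homogeneousSubmodule,
        finrank_linearMap_fractionRing, finrank_symmetricPower b hb]
  exact hrange.ge hG

end SymmetricForms

section SymmetricFormsCx

variable {K : Type} [Field K] (σ : K →+* ℂ)
variable {E J : Type*} [AddCommGroup E] [Module (𝓞 K) E] [Fintype J]

theorem eval₂_symPoly (e : J → E) (z : J → ℂ) (n : ℕ) (Ψ : Sym[𝓞 K]^n E →ₗ[𝓞 K] K) :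
    (symPoly e n Ψ).eval₂ σ z = formCx σ Ψ (symPow σ n (∑ i, z i • toCx σ (e i))) := by
  rw [symPow, MultilinearMap.map_sum, map_sum]
  change MvPolynomial.eval₂ σ z (∑ I : Fin n → J, _) = _
  rw [MvPolynomial.eval₂_sum]
  refine Finset.sum_congr rfl fun I _ => ?_
  rw [MultilinearMap.map_smul_univ, map_smul, multiCx_toCx, formCx_toCx, smul_eq_mul, mul_comm,
    MvPolynomial.eval₂_mul, MvPolynomial.eval₂_C, MvPolynomial.eval₂_prod]
  simp only [MvPolynomial.eval₂_X]

theorem algIndependent_of_no_relation (b : Basis J K (K ⊗[𝓞 K] E)) {e : J → E}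
    (hb : ∀ j, b j = 1 ⊗ₜ[𝓞 K] e j) {z : J → ℂ}
    (h : ∀ (n : ℕ) (G : MvPolynomial J K), G.IsHomogeneous n → G.eval₂ σ z = 0 → G = 0) :
    AlgIndependent σ (∑ i, z i • toCx σ (e i)) := by
  have := σ.charZero
  refine fun n _ => minSubspace_eq_top σ fun Ψ hΨ => ?_
  refine (map_eq_zero_iff (symPoly e n) (symPoly_injective b hb n)).mp ?_
  exact h n _ (isHomogeneous_symPoly e n Ψ) ((eval₂_symPoly σ e z n Ψ).trans hΨ)

end SymmetricFormsCx

section Asymptotics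

theorem multichoose_succ_mul_succ (d n : ℕ) :
    d.multichoose (n + 1) * (n + 1) = d.multichoose n * (n + d) := by
  cases d with
  | zero => cases n <;> simp
  | succ c =>
    rw [Nat.multichoose_eq, Nat.multichoose_eq, show c + 1 + (n + 1) - 1 = n + c + 1 by omega,
      show c + 1 + n - 1 = n + c by omega, ← Nat.add_one_mul_choose_eq, mul_comm, add_assoc]

theorem multichoose_pos {d : ℕ} (hd : 0 < d) (n : ℕ) : 0 < d.multichoose n := by
  rw [Nat.multichoose_eq]
  exact Nat.choose_pos (by omega)

theorem tendsto_multichoose_atTop {d : ℕ} (hd : 1 < d) : Tendsto d.multichoose atTop atTop := by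
  refine tendsto_atTop_mono (fun n => ?_) tendsto_id
  have hle : (n + 1).choose n ≤ (d + n - 1).choose n := Nat.choose_le_choose n (by omega)
  rw [Nat.choose_succ_self_right, ← Nat.multichoose_eq] at hle
  exact (Nat.le_succ n).trans hle

theorem tendsto_multichoose_div_multichoose_add {d : ℕ} (hd : 0 < d) (k : ℕ) :
    Tendsto (fun j => (d.multichoose j / d.multichoose (j + k) : ℝ)) atTop (nhds 1) := by
  have hne : ∀ n, (d.multichoose n : ℝ) ≠ 0 := fun n => mod_cast (multichoose_pos hd n).ne'
  induction k with
  | zero => simp [hne]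
  | succ k ih =>
    have hstep : ∀ n : ℕ, (d.multichoose n / d.multichoose (n + 1) : ℝ) =
        ((n : ℝ) + 1) / (n + d) := fun n => by
      have hd' : (n + d : ℝ) ≠ 0 := by positivity
      rw [div_eq_div_iff (hne _) hd', mul_comm ((n : ℝ) + 1)]
      exact_mod_cast (multichoose_succ_mul_succ d n).symm
    have hlim : Tendsto (fun n : ℕ => ((n : ℝ) + 1) / (n + d)) atTop (nhds 1) := by
      simpa [add_comm] using tendsto_add_mul_div_add_mul_atTop_nhds (1 : ℝ) d 1 (d := 1) one_ne_zero
    have hmul := ih.mul (hlim.comp (tendsto_add_atTop_nat k))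
    rw [one_mul] at hmul
    refine hmul.congr fun j => ?_
    rw [Function.comp_apply, ← hstep, ← add_assoc, div_mul_div_cancel₀ (hne _)]

theorem nonpos_of_frequently_mul_multichoose_le {d : ℕ} (hd : 1 < d) (k : ℕ) {c₁ c₂ c₃ D : ℝ}
    (h : ∃ᶠ j in atTop, c₂ * d.multichoose (j + k) ≤
      D * (d.multichoose (j + k) - d.multichoose j) * c₁ + c₃) : c₂ ≤ 0 := by
  let m : ℕ → ℝ := fun n => d.multichoose n
  have hm : ∀ n, 0 < m n := fun n => Nat.cast_pos.mpr (multichoose_pos (by omega) n)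
  have hratio : Tendsto (fun j => m j / m (j + k)) atTop (nhds 1) :=
    tendsto_multichoose_div_multichoose_add (by omega) k
  have hm_atTop : Tendsto (fun j => m (j + k)) atTop atTop :=
    tendsto_natCast_atTop_atTop.comp ((tendsto_multichoose_atTop hd).comp (tendsto_add_atTop_nat k))
  have hlim :
      Tendsto (fun j => D * (1 - m j / m (j + k)) * c₁ + c₃ / m (j + k)) atTop (nhds 0) := by
    simpa using (((hratio.const_sub 1).const_mul D).mul_const c₁).add (hm_atTop.const_div_atTop c₃)
  refine ge_of_tendsto_of_frequently hlim (h.mono fun j hj => ?_)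
  have hdiv : c₂ ≤ (D * (m (j + k) - m j) * c₁ + c₃) / m (j + k) := (le_div_iff₀ (hm _)).mpr hj
  refine hdiv.trans_eq ?_
  field_simp [(hm (j + k)).ne']

end Asymptotics

theorem exists_integral_coordinates {K : Type} [Field K] [NumberField K] (σ : K →+* ℂ)
    {E J : Type*} [AddCommGroup E] [Module (𝓞 K) E] [Fintype J]
    (b : Basis J K (K ⊗[𝓞 K] E)) (z : J → ℂ) :
    ∃ (c : ℂ) (b' : Basis J K (K ⊗[𝓞 K] E)) (e : J → E), (∀ j, b' j = 1 ⊗ₜ[𝓞 K] e j) ∧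
      ∑ j, z j • genericToCx σ E (b j) = ∑ j, (c * z j) • toCx σ (e j) := by
  obtain ⟨a, b', e, ha, hab, hb'⟩ := exists_smul_basis_eq_one_tmul (R := 𝓞 K) b
  have hσ : σ (algebraMap (𝓞 K) K a) ≠ 0 := by simpa using ha
  refine ⟨(σ (algebraMap (𝓞 K) K a))⁻¹, b', e, hb', Finset.sum_congr rfl fun j _ => ?_⟩
  rw [toCx_eq_genericToCx, ← hb', hab, LinearMap.map_smulₛₗ, smul_smul, mul_right_comm,
    inv_mul_cancel₀ hσ, one_mul]

section Relations

open MvPolynomial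

theorem eq_zero_of_isHomogeneous_of_unique {ι k S : Type*} [Unique ι] [Field k] [CommSemiring S]
    [NoZeroDivisors S] (σ : k →+* S) {z : ι → S} (hz : z default ≠ 0) {n : ℕ}
    {G : MvPolynomial ι k} (hG : G.IsHomogeneous n) (hGz : G.eval₂ σ z = 0) : G = 0 := by
  have := nontrivial_of_ne _ _ hz
  have hrank : finrank k (homogeneousSubmodule ι k n) = 1 := by
    rw [finrank_homogeneousSubmodule, Fintype.card_unique, Nat.multichoose_one]
  have hX : (⟨X default ^ n, isHomogeneous_X_pow default n⟩ : homogeneousSubmodule ι k n) ≠ 0 :=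
    fun h => pow_ne_zero n (X_ne_zero default) (congrArg Subtype.val h)
  obtain ⟨c, hc⟩ := (finrank_eq_one_iff_of_nonzero' _ hX).mp hrank ⟨G, hG⟩
  have hcG : c • X default ^ n = G := congrArg Subtype.val hc
  rw [← hcG, smul_eq_C_mul, eval₂_mul, eval₂_C, eval₂_pow, eval₂_X] at hGz
  rw [← hcG, (map_eq_zero σ).mp ((mul_eq_zero.mp hGz).resolve_right (pow_ne_zero n hz)), zero_smul]

variable {K : Type} [Field K] [NumberField K] {σ : K →+* ℂ}
variable {E : Type*} [AddCommGroup E] [Module (𝓞 K) E] [Module.Finite (𝓞 K) E]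

theorem symPow_ne_zero {f : Cx σ E} (hf : f ≠ 0) (n : ℕ) : symPow σ n f ≠ 0 := by
  obtain ⟨b, e, hb⟩ := exists_basis_eq_one_tmul (R := 𝓞 K) K E
  obtain ⟨z, rfl⟩ := exists_eq_sum_smul_toCx σ b hb f
  obtain ⟨i, hi⟩ : ∃ i, z i ≠ 0 := by
    by_contra! hz
    simp [hz] at hf
  obtain ⟨Ψ, hΨ⟩ := exists_symPoly_eq b hb (isHomogeneous_X_pow (R := K) i n)
  intro h0
  have heval := eval₂_symPoly σ e z n Ψ
  rw [hΨ, h0, map_zero, eval₂_pow, eval₂_X] at heval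
  exact pow_ne_zero n hi heval

variable {J : Type*} [Fintype J] (b : Basis J K (K ⊗[𝓞 K] E)) {e : J → E}
variable (hb : ∀ j, b j = 1 ⊗ₜ[𝓞 K] e j) {z : J → ℂ}

include hb

theorem exists_linearIndependent_forms_of_relation {k : ℕ} {G : MvPolynomial J K}
    (hG : G.IsHomogeneous k) (hG0 : G ≠ 0) (hGz : G.eval₂ σ z = 0) (j : ℕ) :
    ∃ L : Fin ((Fintype.card J).multichoose j) → (Sym[𝓞 K]^(j + k) E →ₗ[𝓞 K] K),
      LinearIndependent K L ∧
      ∀ i, formCx σ (L i) (symPow σ (j + k) (∑ i, z i • toCx σ (e i))) = 0 := by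
  let B := finBasisOfFinrankEq K (homogeneousSubmodule J K j) (finrank_homogeneousSubmodule J K j)
  choose L hL using fun i => exists_symPoly_eq (R := 𝓞 K) b hb ((B i).2.mul hG)
  refine ⟨L, .of_comp (symPoly e (j + k)) ?_, fun i => ?_⟩
  · have hmul : LinearIndependent K fun i => LinearMap.mulRight K G (B i) :=
      (B.linearIndependent.map' (Submodule.subtype _) (Submodule.ker_subtype _)).map' _
        (LinearMap.ker_eq_bot.mpr (mul_left_injective₀ hG0))
    exact (funext hL : symPoly e (j + k) ∘ L = _) ▸ hmul
  · rw [← eval₂_symPoly, hL, eval₂_mul, hGz, mul_zero]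

variable {H : Type*} [AddCommGroup H] [Module (𝓞 K) H] [Module.Invertible (𝓞 K) H]
variable {hE : Metric K E} {hH : Metric K H} {c₁ c₂ c₃ : ℝ}

theorem SmallForms.mul_multichoose_le {b₁ b₂ : ℝ} {j k : ℕ}
    (h : SmallForms (hE.symPower (j + k)) hH σ (symPow σ (j + k) (∑ i, z i • toCx σ (e i)))
      c₁ c₂ c₃ b₁ b₂)
    (hf : ∑ i, z i • toCx σ (e i) ≠ 0) {G : MvPolynomial J K}
    (hG : G.IsHomogeneous k) (hG0 : G ≠ 0) (hGz : G.eval₂ σ z = 0) :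
    c₂ * (Fintype.card J).multichoose (j + k) ≤ finrank ℚ K *
      ((Fintype.card J).multichoose (j + k) - (Fintype.card J).multichoose j) * c₁ + c₃ := by
  obtain ⟨L, hL, hLf⟩ := exists_linearIndependent_forms_of_relation b hb hG hG0 hGz j
  have hbound := h.mul_finrank_le (symPow_ne_zero hf _) hL hLf
  rwa [finrank_symmetricPower b hb, Fintype.card_fin] at hbound

theorem no_relation_of_frequently_smallForms (hf : ∑ i, z i • toCx σ (e i) ≠ 0) (hc₂ : 0 < c₂)
    (hforms : ∃ᶠ n : ℕ in atTop, ∃ b₁ b₂ : ℝ, SmallForms (hE.symPower n) hH σ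
      (symPow σ n (∑ i, z i • toCx σ (e i))) c₁ c₂ c₃ b₁ b₂)
    {k : ℕ} {G : MvPolynomial J K} (hG : G.IsHomogeneous k) (hGz : G.eval₂ σ z = 0) : G = 0 := by
  obtain ⟨i, hi⟩ : ∃ i, z i ≠ 0 := by
    by_contra! hz
    simp [hz] at hf
  rcases subsingleton_or_nontrivial J with _ | _
  · have := uniqueOfSubsingleton i
    exact eq_zero_of_isHomogeneous_of_unique σ (Subsingleton.elim i default ▸ hi) hG hGz
  by_contra hG0
  have hshift : ∃ᶠ j in atTop, ∃ b₁ b₂ : ℝ, SmallForms (hE.symPower (j + k)) hH σ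
      (symPow σ (j + k) (∑ i, z i • toCx σ (e i))) c₁ c₂ c₃ b₁ b₂ := by
    rwa [← map_add_atTop_eq_nat k, frequently_map] at hforms
  exact hc₂.not_ge <| nonpos_of_frequently_mul_multichoose_le Fintype.one_lt_card k <|
    hshift.mono fun j ⟨b₁, b₂, h⟩ => h.mul_multichoose_le b hb hf hG hG0 hGz

end Relations

end Hermitian

theorem mainTheorem7_general {K : Type} [Field K] [NumberField K] (σ : K →+* ℂ)
    {E : Type*} [AddCommGroup E] [Module (𝓞 K) E] [Module.Finite (𝓞 K) E]
    (hE : Hermitian.Metric K E)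
    {H : Type*} [AddCommGroup H] [Module (𝓞 K) H] [Module.Invertible (𝓞 K) H]
    (hH : Hermitian.Metric K H)
    (f : Hermitian.Cx σ E) (hf : f ≠ 0)
    (c₁ c₂ c₃ : ℝ) (hc₂ : 0 < c₂)
    (hforms : ∃ᶠ n : ℕ in atTop, ∃ b₁ b₂ : ℝ,
      Hermitian.SmallForms (hE.symPower n) hH σ (Hermitian.symPow σ n f) c₁ c₂ c₃ b₁ b₂) :
    Hermitian.AlgIndependent σ f ∧
    ∀ (d : ℕ) (e : Basis (Fin d) K (K ⊗[𝓞 K] E)) (z : Fin d → ℂ),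
      f = ∑ i, z i • Hermitian.genericToCx σ E (e i) →
      ∀ (n : ℕ) (G : MvPolynomial (Fin d) K), G.IsHomogeneous n →
        MvPolynomial.eval₂ σ z G = 0 → G = 0 := by
  constructor
  · obtain ⟨b, e, hb⟩ := Hermitian.exists_basis_eq_one_tmul (R := 𝓞 K) K E
    obtain ⟨z, rfl⟩ := Hermitian.exists_eq_sum_smul_toCx σ b hb f
    exact Hermitian.algIndependent_of_no_relation σ b hb fun n G hG hGz =>
      Hermitian.no_relation_of_frequently_smallForms b hb hf hc₂ hforms hG hGz
  · rintro d b z rfl n G hG hGz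
    obtain ⟨c, b', e, hb', hsum⟩ := Hermitian.exists_integral_coordinates σ b z
    rw [hsum] at hf hforms
    refine Hermitian.no_relation_of_frequently_smallForms b' hb' hf hc₂ hforms hG ?_
    rw [Hermitian.eval₂_mul_left_of_isHomogeneous σ hG, hGz, mul_zero]

theorem mainTheorem7 {K : Type} [Field K] [NumberField K] (σ : K →+* ℂ)
    {E : Type*} [AddCommGroup E] [Module (𝓞 K) E] [Module.Finite (𝓞 K) E]
    [Module.Projective (𝓞 K) E] (hE : Hermitian.Metric K E)
    {H : Type*} [AddCommGroup H] [Module (𝓞 K) H] [Module.Invertible (𝓞 K) H]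
    (hH : Hermitian.Metric K H)
    (f : Hermitian.Cx σ E) (hf : f ≠ 0)
    (c₁ c₂ c₃ : ℝ) (hc₂ : 0 < c₂)
    (hforms : ∀ᶠ n : ℕ in atTop, ∃ b₁ b₂ : ℝ,
      Hermitian.SmallForms (hE.symPower n) hH σ (Hermitian.symPow σ n f) c₁ c₂ c₃ b₁ b₂) :
    Hermitian.AlgIndependent σ f ∧
    ∀ (d : ℕ) (e : Basis (Fin d) K (K ⊗[𝓞 K] E)) (z : Fin d → ℂ),
      f = ∑ i, z i • Hermitian.genericToCx σ E (e i) →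
      ∀ (n : ℕ) (G : MvPolynomial (Fin d) K), G.IsHomogeneous n →
        MvPolynomial.eval₂ σ z G = 0 → G = 0 := by
  exact mainTheorem7_general σ hE hH f hf c₁ c₂ c₃ hc₂ hforms.frequently
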